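/- Let $p$ be a prime, $F$ a number field, and $w$ a finite place of $F$ not dividing $p$, with completion $F_w$, residue field of cardinality $q$, absolute Galois group $\mathrm{Gal}_{F_w}$, inertia group $I_{F_w}$ and Weil group $W_{F_w}$. Let $\|\cdot\|: W_{F_w}\to q^{\mathbb{Z}}$ be the homomorphism trivial on $I_{F_w}$ with $\|\Phi\|=q^{-1}$ for every geometric Frobenius element $\Phi$ (an element whose inverse acts as $x\mapsto x^q$ on the residue field of $\overline{F_w}$). Let $E/\mathbb{Q}_p$ be a finite extension, and let $A$ be an affinoid $E$-algebra (a quotient of a Tate algebra $E\langle X_1,\dots,X_m\rangle$, with its canonical Banach topology), not necessarily reduced. Fix a continuous surjective homomorphism $t_p: I_{F_w}\twoheadrightarrow\mathbb{Z}_p$, and let $\rho:\mathrm{Gal}_{F_w}\to\mathrm{GL}_n(A)$ be a continuous homomorphism. Then: (1) There is a unique nilpotent matrix $N\in M_n(A)$ for which there exists an open subgroup $J\subset I_{F_w}$ such that $\rho(\gamma)=\exp(t_p(\gamma)N)$ for all $\gamma\in J$. (2) For this $N$ and every geometric Frobenius element $\Phi\in W_{F_w}$, there is a unique homomorphism $\tilde\rho: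 W_{F_w}\to\mathrm{GL}_n(A)$ such that $(\tilde\rho,N)$ is a Weil–Deligne representation over $A$ and $\rho(\Phi^s\gamma)=\tilde\rho(\Phi^s\gamma)\exp(t_p(\gamma)N)$ for all $s\in\mathbb{Z}$ and $\gamma\in I_{F_w}$. Here, that $(\tilde\rho,N)$ is a Weil–Deligne representation over $A$ means that $\tilde\rho$ is trivial on an open subgroup of $I_{F_w}$, that $N$ is nilpotent, and that $\tilde\rho(\sigma)N\tilde\rho(\sigma)^{-1}=\|\sigma\|N$ for all $\sigma\in W_{F_w}$. -/

import Mathlib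

open IsDedekindDomain NumberField

/-! ### Tate algebras and affinoid algebras -/

/-- The Tate algebra `E⟨X₁, …, X_m⟩`: the power series over `E` whose coefficients tend to `0`. -/
noncomputable def TateAlgebra (E : Type*) [NormedField E] [IsUltrametricDist E] (m : ℕ) :
    Subalgebra E (MvPowerSeries (Fin m) E) where
  carrier := {f | MvPowerSeries.IsRestricted (fun _ => (1 : ℝ)) f}
  mul_mem' := MvPowerSeries.isRestricted.mul _
  add_mem' := MvPowerSeries.isRestricted.add _
  algebraMap_mem' := fun a => MvPowerSeries.isRestricted_C _ a

/-- An `E`-algebra `A` with an algebra norm is affinoid if it is a (non-archimedean) `E`-Banach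
algebra and there is a continuous surjective homomorphism of `E`-algebras onto `A` from a
Tate algebra, the latter being normed by the Gauss norm. (By the open mapping theorem
the topology of `A` is then the quotient topology; every quotient of a Tate algebra is of this
form with a residue norm, and its Banach topology is unique.) -/
structure IsAffinoidAlgebra (E A : Type*) [NormedField E] [IsUltrametricDist E]
    [NormedCommRing A] [NormedAlgebra E A] : Prop where
  complete : CompleteSpace A
  ultrametric : IsUltrametricDist A
  exists_presentation : ∃ (m : ℕ) (φ : TateAlgebra E m →ₐ[E] A),
    Function.Surjective φ ∧
    ∃ C : ℝ, ∀ f : TateAlgebra E m,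
      ‖φ f‖ ≤ C * MvPowerSeries.gaussNorm (fun a : E => ‖a‖) (fun _ => (1 : ℝ)) f.1

/-! ### Inertia group, Frobenius elements and Weil group -/

section Galois

variable {K : Type*} [Field K]

/-- The absolute Galois group of `K`, with the Krull topology. -/
abbrev AbsGal (K : Type*) [Field K] : Type _ := AlgebraicClosure K ≃ₐ[K] AlgebraicClosure K

/-- The Jacobson radical of the integral closure of `O` in the algebraic closure of `K`. When `O`
is the valuation ring of a local field, this integral closure is a local ring, and this is
its maximal ideal. -/
noncomputable def residueIdeal (O : ValuationSubring K) :
    Ideal (integralClosure O (AlgebraicClosure K)) :=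
  Ring.jacobson _

/-- The inertia group: the automorphisms that act trivially on the residue field of the algebraic
closure. -/
noncomputable def inertiaGroup (O : ValuationSubring K) : Subgroup (AbsGal K) :=
  (residueIdeal O).inertia (AbsGal K)

/-- The number `q` of elements of the residue field of `O`. -/
noncomputable def residueCard (O : ValuationSubring K) : ℕ :=
  Nat.card (IsLocalRing.ResidueField O)

/-- Arithmetic Frobenius elements: those acting as `x ↦ x ^ q` on the residue field of the
algebraic closure. -/
def IsArithFrobenius (O : ValuationSubring K) (σ : AbsGal K) : Prop :=
  ∀ x : integralClosure O (AlgebraicClosure K), σ • x - x ^ residueCard O ∈ residueIdeal O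

/-- Geometric Frobenius elements: the inverses of arithmetic ones. -/
def IsGeomFrobenius (O : ValuationSubring K) (σ : AbsGal K) : Prop :=
  IsArithFrobenius O σ⁻¹

/-- The Weil group: the automorphisms acting on the residue field of the algebraic closure as
an integral power of Frobenius, i.e. the subgroup generated by the Frobenius elements
and the inertia group. -/
noncomputable def weilGroup (O : ValuationSubring K) : Subgroup (AbsGal K) :=
  Subgroup.closure {σ | IsArithFrobenius O σ} ⊔ inertiaGroup O

theorem inertiaGroup_le_weilGroup (O : ValuationSubring K) : inertiaGroup O ≤ weilGroup O :=
  le_sup_right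

/-- `σ` acts on the residue field of the algebraic closure as the `d`-th power of the arithmetic
Frobenius; thus `‖σ‖ = q ^ d`, and `‖Φ‖ = q⁻¹` for a geometric Frobenius `Φ`. -/
def HasFrobeniusDegree (O : ValuationSubring K) (σ : AbsGal K) (d : ℤ) : Prop :=
  ∃ φ : AbsGal K, IsArithFrobenius O φ ∧ φ ^ (-d) * σ ∈ inertiaGroup O

/-- Weil–Deligne representations `(r, N)` on `A ^ n`, where `A` is an algebra over a field `E` of
characteristic `0`: `r` is trivial on an open subgroup of inertia, `N` is nilpotent,
and `r(σ) N r(σ)⁻¹ = ‖σ‖ N` for all `σ` in the Weil group. -/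
structure IsWeilDeligneRep (E : Type*) {A : Type*} [Field E] [CommRing A] [Algebra E A]
    (O : ValuationSubring K) {n : ℕ} (r : weilGroup O →* GL (Fin n) A)
    (N : Matrix (Fin n) (Fin n) A) : Prop where
  nilpotent : IsNilpotent N
  smooth : ∃ J : OpenSubgroup (inertiaGroup O),
    ∀ γ ∈ J, r (Subgroup.inclusion (inertiaGroup_le_weilGroup O) γ) = 1
  relation : ∀ (σ : weilGroup O) (d : ℤ), HasFrobeniusDegree O (σ : AbsGal K) d →
    (r σ : Matrix (Fin n) (Fin n) A) * N * ((r σ)⁻¹ : GL (Fin n) A) =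
      ((residueCard O : E) ^ d) • N

/-- `N` is nilpotent and `ρ(γ) = exp(t(γ) N)` for all `γ` in some open subgroup of inertia. -/
def IsMonodromyOperator {p : ℕ} [Fact p.Prime] (E : Type*) {A : Type*} [NormedField E]
    [NormedAlgebra ℚ_[p] E] [NormedCommRing A] [NormedAlgebra E A]
    (O : ValuationSubring K) (t : inertiaGroup O →* Multiplicative ℤ_[p])
    {n : ℕ} (ρ : AbsGal K →* GL (Fin n) A) (N : Matrix (Fin n) (Fin n) A) : Prop :=
  IsNilpotent N ∧ ∃ J : OpenSubgroup (inertiaGroup O), ∀ γ ∈ J,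
    (ρ (γ : AbsGal K) : Matrix (Fin n) (Fin n) A) =
      NormedSpace.exp (algebraMap ℚ_[p] E ((t γ).toAdd : ℚ_[p]) • N)

end Galois

/-!
Grothendieck's `ℓ`-adic monodromy theorem with coefficients in an affinoid algebra `A`.

Let `K` be the local field and `ν` the spectral norm of its algebraic closure, so that the integral
closure of `O` is the unit ball of `ν`. A finite extension `L` has a uniformizer `π`
(`exists_uniformizer`), and the tame character `σ ↦ σ π / π` on inertia (`tameCharacter`) takes
values in the multiplicative group of a field. An inertia element in its kernel acts on `L` with
order prime to `p` (`exists_coprime_pow_eq_one`); this is a trace argument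
(`eq_of_spectralNorm_sub_lt`). It follows that the `p`-subgroups of finite quotients of inertia are
cyclic, so that `t : I → ℤ_p` accounts for all pro-`p` phenomena: modulo an open normal subgroup,
elements with `t` divisible by a large power of `p` have order prime to `p`
(`exists_coprime_pow_restrictNormalHom`). Since Frobenius raises tame characters to the `q`-th power,
`t (φ γ φ⁻¹) = q t (γ)` (`toAdd_conj_arithFrobenius`).

Small balls around `1` in `GL_n(A)` are pro-`p`. Hence `ρ`, restricted to the inertia elements that it
sends into such a ball, is a continuous function of `t`. For one such element `γ` with `t γ = n ≠ 0`
the logarithm `x = lim (ρ(γ) ^ p ^ j - 1) / p ^ j` exists (`exists_hasPadicLog`), and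
conjugation by `ρ(φ)` multiplies it by `q`. Comparing characteristic polynomials,
`q ^ i ≠ 1` for `i ≠ 0` forces `x` to be nilpotent (`Matrix.isNilpotent_of_conj_eq_smul`); this
works over any commutative ring containing `ℚ`, reduced or not. Then `N = n⁻¹ x` satisfies
`ρ(γ) = exp(t(γ) N)` for all `γ` near `1` (`exists_eq_exp_coeffCharacter`), and it is unique because
`N` is the logarithm of `exp N`.

By the same uniqueness `ρ(σ) N ρ(σ)⁻¹ = ‖σ‖ N` on the Weil group (`monodromy_conj`), and this is what
makes `Φ ^ s γ ↦ ρ(Φ ^ s γ) exp(-t(γ) N)` a homomorphism. Of the hypothesis on `A`, only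
its structure as a commutative ultrametric Banach algebra over `E` enters.
-/


/-! ### Exponentials of nilpotent elements and `p`-adic logarithms -/

section NilpotentExp

variable {E B : Type*} [NormedField E] [CharZero E] [Ring B] [Algebra E B]
  [TopologicalSpace B] [IsTopologicalRing B] [T2Space B]

variable (E) in
omit [T2Space B] in
theorem NormedSpace.exp_eq_sum_of_pow_eq_zero {x : B} {k : ℕ} (h : x ^ k = 0) :
    NormedSpace.exp x = ∑ i ∈ Finset.range k, ((i.factorial : E)⁻¹) • x ^ i := by
  rw [NormedSpace.exp_eq_tsum E]
  refine tsum_eq_sum fun i hi => ?_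
  rw [Finset.mem_range, not_lt] at hi
  rw [pow_eq_zero_of_le hi h, smul_zero]

variable (E) in
include E in
omit [T2Space B] in
theorem NormedSpace.exp_add_of_commute_of_isNilpotent {x y : B} (h : Commute x y)
    (hx : IsNilpotent x) (hy : IsNilpotent y) :
    NormedSpace.exp (x + y) = NormedSpace.exp x * NormedSpace.exp y := by
  let _ : Algebra ℚ B := Algebra.compHom B (algebraMap ℚ E)
  have key : ∀ {z : B}, IsNilpotent z → NormedSpace.exp z = IsNilpotent.exp z := by
    rintro z ⟨k, hk⟩
    rw [NormedSpace.exp_eq_sum_of_pow_eq_zero ℚ hk, IsNilpotent.exp_eq_sum hk]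
  rw [key hx, key hy, key (h.isNilpotent_add hx hy), IsNilpotent.exp_add_of_commute h hx hy]

variable [ContinuousSMul E B]

omit [T2Space B] in
theorem NormedSpace.continuous_exp_smul {x : B} (hx : IsNilpotent x) :
    Continuous fun s : E => NormedSpace.exp (s • x) := by
  obtain ⟨k, hk⟩ := hx
  have : (fun s : E => NormedSpace.exp (s • x)) = fun s : E =>
      ∑ i ∈ Finset.range k, ((i.factorial : E)⁻¹) • (s • x) ^ i := by
    funext s
    exact NormedSpace.exp_eq_sum_of_pow_eq_zero E (by rw [smul_pow, hk, smul_zero])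
  rw [this]
  fun_prop

omit [T2Space B] in
/-- The derivative at `0` of `s ↦ exp (s x)`, for nilpotent `x`. -/
theorem NormedSpace.tendsto_inv_smul_exp_smul_sub_one {x : B} (hx : IsNilpotent x) {s : ℕ → E}
    (hs0 : ∀ j, s j ≠ 0) (hs : Filter.Tendsto s Filter.atTop (nhds 0)) :
    Filter.Tendsto (fun j => (s j)⁻¹ • (NormedSpace.exp (s j • x) - 1)) Filter.atTop (nhds x) := by
  obtain ⟨k, hk⟩ := hx
  let f : E → B := fun a =>
    ∑ i ∈ Finset.range (k + 1), (((i + 1).factorial : E)⁻¹) • a ^ i • x ^ (i + 1)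
  have hf : Continuous f := by fun_prop
  have hf0 : f 0 = x := by
    simp only [f]
    rw [Finset.sum_range_succ', Finset.sum_eq_zero fun i _ => by simp]
    simp
  have h1 : ∀ j, (s j)⁻¹ • (NormedSpace.exp (s j • x) - 1) = f (s j) := by
    intro j
    have hk' : (s j • x) ^ (k + 2) = 0 := by
      rw [smul_pow, pow_add x, hk, zero_mul, smul_zero]
    rw [NormedSpace.exp_eq_sum_of_pow_eq_zero E hk', Finset.sum_range_succ']
    simp only [Nat.factorial_zero, Nat.cast_one, inv_one, pow_zero, one_smul, add_sub_cancel_right,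
      Finset.smul_sum, f]
    refine Finset.sum_congr rfl fun i _ => ?_
    rw [smul_pow, smul_smul, smul_smul, smul_smul]
    congr 1
    rw [pow_succ' (s j), mul_left_comm, mul_assoc (s j)⁻¹, mul_inv_cancel_left₀ (hs0 j)]
  simp only [h1]
  have := (hf.tendsto 0).comp hs
  rwa [hf0] at this

end NilpotentExp

section PadicLog

/-- `x` is the `p`-adic logarithm of `u`, as the limit of `(u ^ p ^ j - 1) / p ^ j`. -/
def HasPadicLog (p : ℕ) (E : Type*) {B : Type*} [Field E] [Ring B] [Algebra E B]
    [TopologicalSpace B] (u x : B) : Prop :=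
  Filter.Tendsto (fun j : ℕ => ((p : E) ^ j)⁻¹ • (u ^ p ^ j - 1)) Filter.atTop (nhds x)

variable {p : ℕ} [hp : Fact p.Prime] {E : Type*} [NormedField E] [NormedAlgebra ℚ_[p] E]

theorem norm_natCast_prime : ‖(p : E)‖ = (p : ℝ)⁻¹ := by
  rw [← map_natCast (algebraMap ℚ_[p] E) p, norm_algebraMap', Padic.norm_p]

variable (p E) in
include p in
theorem charZero_of_normedAlgebra_padic : CharZero E :=
  charZero_of_injective_algebraMap (algebraMap ℚ_[p] E).injective

variable (p E) in
theorem tendsto_natCast_prime_pow :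
    Filter.Tendsto (fun j : ℕ => (p : E) ^ j) Filter.atTop (nhds 0) := by
  refine tendsto_pow_atTop_nhds_zero_of_norm_lt_one ?_
  rw [norm_natCast_prime]
  exact inv_lt_one_of_one_lt₀ (by exact_mod_cast hp.out.one_lt)

variable (p E) in
theorem natCast_prime_ne_zero : (p : E) ≠ 0 := by
  have := charZero_of_normedAlgebra_padic p E
  exact_mod_cast hp.out.ne_zero

section Topological

variable {B : Type*} [Ring B] [Algebra E B] [TopologicalSpace B] [IsTopologicalRing B]
  [T2Space B] [ContinuousSMul E B]

namespace HasPadicLog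

omit [T2Space B] in
theorem tendsto_pow {u x : B} (h : HasPadicLog p E u x) :
    Filter.Tendsto (fun j : ℕ => u ^ p ^ j) Filter.atTop (nhds 1) := by
  have h1 := ((tendsto_natCast_prime_pow p E).smul h).add_const 1
  simp only [zero_smul, zero_add] at h1
  refine h1.congr fun j => ?_
  rw [smul_inv_smul₀ (pow_ne_zero _ (natCast_prime_ne_zero p E)), sub_add_cancel]

omit hp [NormedAlgebra ℚ_[p] E] [IsTopologicalRing B] [ContinuousSMul E B] in
protected theorem unique {u x y : B} (h : HasPadicLog p E u x) (h' : HasPadicLog p E u y) : x = y :=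
  tendsto_nhds_unique h h'

omit hp [NormedAlgebra ℚ_[p] E] [T2Space B] [ContinuousSMul E B] in
theorem conj {u x : B} (h : HasPadicLog p E u x) (g : Bˣ) :
    HasPadicLog p E (g * u * (g⁻¹ : Bˣ)) (g * x * (g⁻¹ : Bˣ)) := by
  refine ((h.const_mul (g : B)).mul_const ((g⁻¹ : Bˣ) : B)).congr fun j => ?_
  rw [Units.conj_pow, mul_smul_comm, smul_mul_assoc, mul_sub, sub_mul, mul_one, Units.mul_inv]

omit [T2Space B] in
theorem pow {u x : B} (h : HasPadicLog p E u x) (m : ℕ) : HasPadicLog p E (u ^ m) (m • x) := by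
  have h1 : Filter.Tendsto (fun j : ℕ => ∑ i ∈ Finset.range m, (u ^ p ^ j) ^ i)
      Filter.atTop (nhds (∑ i ∈ Finset.range m, (1 : B) ^ i)) :=
    tendsto_finsetSum _ fun i _ => h.tendsto_pow.pow i
  have h2 := h1.mul h
  simp only [one_pow, Finset.sum_const, Finset.card_range, smul_mul_assoc, one_mul] at h2
  refine h2.congr fun j => ?_
  rw [mul_smul_comm, geom_sum_mul, ← pow_mul, ← pow_mul, mul_comm]

omit [T2Space B] in
theorem mul {u v x y : B} (huv : Commute u v) (hu : HasPadicLog p E u x)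
    (hv : HasPadicLog p E v y) : HasPadicLog p E (u * v) (x + y) := by
  have h := (Filter.Tendsto.mul hu hv.tendsto_pow).add hv
  rw [mul_one] at h
  refine h.congr fun j => ?_
  rw [huv.mul_pow, smul_mul_assoc, ← smul_add]
  congr 1
  noncomm_ring

omit hp [NormedAlgebra ℚ_[p] E] [ContinuousSMul E B] in
theorem commute {u x v : B} (h : HasPadicLog p E u x) (huv : Commute u v) : Commute x v := by
  refine tendsto_nhds_unique (h.mul_const v) ((h.const_mul v).congr fun j => ?_)
  exact ((huv.pow_left _).sub_left (Commute.one_left v)).smul_left _ |>.eq.symm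

end HasPadicLog

variable (E) in
omit hp [NormedAlgebra ℚ_[p] E] [ContinuousSMul E B] in
omit [T2Space B] in
theorem NormedSpace.exp_pow_of_isNilpotent [CharZero E] {x : B} (hx : IsNilpotent x) (m : ℕ) :
    NormedSpace.exp x ^ m = NormedSpace.exp ((m : E) • x) := by
  have hn : ∀ c : E, IsNilpotent (c • x) := fun c => hx.smul c
  induction m with
  | zero => simp [NormedSpace.exp_eq_sum_of_pow_eq_zero E (x := (0 : B)) (pow_one 0)]
  | succ m ih =>
    rw [pow_succ, ih, Nat.cast_succ, add_smul, one_smul,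
      NormedSpace.exp_add_of_commute_of_isNilpotent E _ (hn _) hx]
    exact (Commute.refl x).smul_left _

omit [T2Space B] in
theorem hasPadicLog_exp {x : B} (hx : IsNilpotent x) : HasPadicLog p E (NormedSpace.exp x) x := by
  have := charZero_of_normedAlgebra_padic p E
  have h := NormedSpace.tendsto_inv_smul_exp_smul_sub_one hx
    (fun j => pow_ne_zero j (natCast_prime_ne_zero p E)) (tendsto_natCast_prime_pow p E)
  refine h.congr fun j => ?_
  rw [NormedSpace.exp_pow_of_isNilpotent E hx, Nat.cast_pow]

end Topological

section Ultrametric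

variable {B : Type*} [NormedRing B] [NormedAlgebra E B] [IsUltrametricDist B]

omit hp [NormedField E] [NormedAlgebra ℚ_[p] E] [NormedAlgebra E B] in
theorem norm_natCast_mul_le (m : ℕ) (x : B) : ‖(m : B) * x‖ ≤ ‖x‖ := by
  induction m with
  | zero => simp
  | succ m ih =>
    rw [Nat.cast_succ, add_mul, one_mul]
    exact (IsUltrametricDist.norm_add_le_max _ _).trans (max_le ih le_rfl)

/-- The terms of degree at least two in the binomial expansion of `u ^ m` at `1` have integral
coefficients. -/
theorem norm_pow_sub_one_sub_le {u : B} (hu : ‖u - 1‖ ≤ 1) (m : ℕ) :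
    ‖u ^ m - 1 - m * (u - 1)‖ ≤ ‖u - 1‖ ^ 2 := by
  induction m with
  | zero => simp
  | succ m ih =>
    have h1 : u ^ (m + 1) - 1 - (m + 1 : ℕ) * (u - 1) =
        ((u ^ m - 1 - m * (u - 1)) + (u ^ m - 1 - m * (u - 1)) * (u - 1)) +
          m * ((u - 1) * (u - 1)) := by
      push_cast
      noncomm_ring
    have h2 : ‖(u - 1) * (u - 1)‖ ≤ ‖u - 1‖ ^ 2 := by
      rw [pow_two]
      exact norm_mul_le _ _
    rw [h1]
    refine (IsUltrametricDist.norm_add_le_max _ _).trans (max_le ?_ ?_)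
    · refine (IsUltrametricDist.norm_add_le_max _ _).trans (max_le ih ?_)
      exact (norm_mul_le _ _).trans ((mul_le_of_le_one_right (norm_nonneg _) hu).trans ih)
    · exact (norm_natCast_mul_le _ _).trans h2

variable (E) in
include E in
omit [IsUltrametricDist B] in
theorem norm_natCast_prime_mul (x : B) : ‖(p : B) * x‖ = (p : ℝ)⁻¹ * ‖x‖ := by
  rw [← norm_natCast_prime (p := p) (E := E), ← norm_smul, Algebra.smul_def, map_natCast]


variable (E) in
include E in
/-- Within distance `1 / p` of `1`, taking `p`-th powers divides the distance to `1` by exactly `p`. -/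
theorem norm_pow_prime_pow_sub_one {u : B} (hu : ‖u - 1‖ < (p : ℝ)⁻¹) (j : ℕ) :
    ‖u ^ p ^ j - 1‖ = (p : ℝ)⁻¹ ^ j * ‖u - 1‖ := by
  have hp1 : (p : ℝ)⁻¹ ≤ 1 := inv_le_one_of_one_le₀ (by exact_mod_cast hp.out.one_lt.le)
  have hp0 : 0 < (p : ℝ)⁻¹ := inv_pos.2 (by exact_mod_cast hp.out.pos)
  -- one step: the linear term `p (v - 1)` dominates the rest of the binomial expansion
  have step : ∀ v : B, ‖v - 1‖ < (p : ℝ)⁻¹ → ‖v ^ p - 1‖ = (p : ℝ)⁻¹ * ‖v - 1‖ := by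
    intro v hv
    rcases eq_or_ne v 1 with rfl | hne
    · simp
    have hpos : 0 < ‖v - 1‖ := norm_pos_iff.2 (sub_ne_zero.2 hne)
    have h1 := norm_pow_sub_one_sub_le (hv.le.trans hp1) p
    have h2 : ‖v ^ p - 1 - p * (v - 1)‖ < ‖(p : B) * (v - 1)‖ := by
      rw [norm_natCast_prime_mul E]
      refine h1.trans_lt ?_
      rw [pow_two]
      exact mul_lt_mul_of_pos_right hv hpos
    have h3 := IsUltrametricDist.norm_add_eq_max_of_norm_ne_norm h2.ne
    rw [sub_add_cancel, max_eq_right h2.le, norm_natCast_prime_mul E] at h3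
    exact h3
  induction j with
  | zero => simp
  | succ j ih =>
    have hlt : ‖u ^ p ^ j - 1‖ < (p : ℝ)⁻¹ := by
      rw [ih]
      exact (mul_le_of_le_one_left (norm_nonneg _) (pow_le_one₀ hp0.le hp1)).trans_lt hu
    rw [pow_succ p, pow_mul, step _ hlt, ih, pow_succ']
    ring

/-- Consecutive terms of the sequence `(u ^ p ^ j - 1) / p ^ j` differ by `O(p ^ (-j))`. -/
theorem exists_hasPadicLog [CompleteSpace B] {u : B} (hu : ‖u - 1‖ < (p : ℝ)⁻¹) :
    ∃ x : B, HasPadicLog p E u x := by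
  have hp1 : (p : ℝ)⁻¹ < 1 := inv_lt_one_of_one_lt₀ (by exact_mod_cast hp.out.one_lt)
  have hp0 : (0 : ℝ) < p := by exact_mod_cast hp.out.pos
  have hpE : (p : E) ≠ 0 := natCast_prime_ne_zero p E
  refine cauchySeq_tendsto_of_complete
    (cauchySeq_of_le_geometric (p : ℝ)⁻¹ (p * ‖u - 1‖ ^ 2) hp1 fun j => ?_)
  have h0 := norm_pow_prime_pow_sub_one E hu j
  have hle : ‖u ^ p ^ j - 1‖ ≤ 1 := by
    rw [h0]
    exact mul_le_one₀ (pow_le_one₀ (inv_nonneg.2 hp0.le) hp1.le) (norm_nonneg _)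
      (hu.le.trans hp1.le)
  have h1 := norm_pow_sub_one_sub_le hle p
  have h2 : ((p : E) ^ (j + 1))⁻¹ • (u ^ p ^ (j + 1) - 1) - ((p : E) ^ j)⁻¹ • (u ^ p ^ j - 1) =
      ((p : E) ^ (j + 1))⁻¹ • ((u ^ p ^ j) ^ p - 1 - p * (u ^ p ^ j - 1)) := by
    have h3 : (p : B) * (u ^ p ^ j - 1) = (p : E) • (u ^ p ^ j - 1) := by
      rw [Algebra.smul_def, map_natCast]
    rw [← pow_mul, ← pow_succ, h3, smul_sub _ _ ((p : E) • _), smul_smul, pow_succ, mul_inv,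
      inv_mul_cancel_right₀ hpE]
  rw [dist_comm, dist_eq_norm, h2, norm_smul, norm_inv, norm_pow, norm_natCast_prime]
  calc _ ≤ ((p : ℝ)⁻¹ ^ (j + 1))⁻¹ * ((p : ℝ)⁻¹ ^ j * ‖u - 1‖) ^ 2 := by
        rw [← h0]; gcongr
    _ = _ := by
        rw [pow_succ (p : ℝ)⁻¹]
        field_simp

/-- The terms `(u ^ p ^ j - 1) / p ^ j` all have the norm of `u - 1`, so the logarithm is injective
at `1` on the ball of radius `1 / p`. -/
theorem HasPadicLog.eq_one {u : B} (h : HasPadicLog p E u 0) (hu : ‖u - 1‖ < (p : ℝ)⁻¹) :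
    u = 1 := by
  have hp0 : (p : ℝ) ≠ 0 := by exact_mod_cast hp.out.ne_zero
  have h1 : Filter.Tendsto (fun _ : ℕ => ‖u - 1‖) Filter.atTop (nhds 0) := by
    have h2 := h.norm
    rw [norm_zero] at h2
    refine h2.congr fun j => ?_
    rw [norm_smul, norm_inv, norm_pow, norm_natCast_prime, norm_pow_prime_pow_sub_one E hu,
      inv_mul_cancel_left₀ (pow_ne_zero _ (inv_ne_zero hp0))]
  exact sub_eq_zero.1 (norm_eq_zero.1 (tendsto_nhds_unique tendsto_const_nhds h1))

/-- A logarithm that is nilpotent can be exponentiated back, after passing to a power of `u`. -/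
theorem HasPadicLog.exists_pow_eq_exp {u x : B} (h : HasPadicLog p E u x) (hx : IsNilpotent x) :
    ∃ j : ℕ, u ^ p ^ j = NormedSpace.exp ((p : E) ^ j • x) := by
  have := charZero_of_normedAlgebra_padic p E
  have hnx : Commute (NormedSpace.exp (-x)) u :=
    (h.commute (Commute.refl u)).neg_left.exp_left
  -- the logarithm of `exp (-x) u` vanishes, so a power of it close to `1` is `1`
  have he : HasPadicLog p E (NormedSpace.exp (-x) * u) 0 := by
    have := (hasPadicLog_exp (p := p) (E := E) hx.neg).mul hnx h
    rwa [neg_add_cancel] at this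
  have hp0 : 0 < (p : ℝ)⁻¹ := inv_pos.2 (by exact_mod_cast hp.out.pos)
  obtain ⟨j, hj⟩ := (he.tendsto_pow.eventually (Metric.ball_mem_nhds 1 hp0)).exists
  rw [dist_eq_norm] at hj
  have h1 : (NormedSpace.exp (-x) * u) ^ p ^ j = 1 :=
    HasPadicLog.eq_one (by simpa using he.pow (p ^ j)) hj
  refine ⟨j, ?_⟩
  rw [hnx.mul_pow, NormedSpace.exp_pow_of_isNilpotent E hx.neg, Nat.cast_pow, smul_neg] at h1
  have hs : IsNilpotent ((p : E) ^ j • x) := hx.smul _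
  have h2 := NormedSpace.exp_add_of_commute_of_isNilpotent E
    (Commute.neg_right (Commute.refl ((p : E) ^ j • x))) hs hs.neg
  rw [add_neg_cancel, NormedSpace.exp_zero] at h2
  exact (left_inv_eq_right_inv h2.symm h1).symm

end Ultrametric

end PadicLog

section MatrixNilpotent

/-- If `N` is conjugate to `c N`, the coefficients of its characteristic polynomial are multiplied
by powers of `c`, so that all but the leading one vanish. -/
theorem Matrix.isNilpotent_of_conj_eq_smul {E A : Type*} [Field E] [CommRing A] [Algebra E A] {n : ℕ}
    {N : Matrix (Fin n) (Fin n) A} {g : GL (Fin n) A} {c : E} (hc0 : c ≠ 0)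
    (hc : ∀ i : ℕ, i ≠ 0 → c ^ i ≠ 1)
    (h : (g : Matrix (Fin n) (Fin n) A) * N * ((g⁻¹ : GL (Fin n) A) : Matrix _ _ A) = c • N) :
    IsNilpotent N := by
  have hchar : (c • N).charpoly = N.charpoly := by
    rw [← h, Matrix.coe_units_inv]
    exact Matrix.charpoly_units_conj g N
  -- `det (c X - c N) = c ^ n det (X - N)`
  have hcomp : (c • N).charpoly.comp (Polynomial.C (algebraMap E A c) * Polynomial.X) =
      Polynomial.C (algebraMap E A c ^ n) * N.charpoly := by
    have h1 : (c • N).charpoly.comp (Polynomial.C (algebraMap E A c) * Polynomial.X) =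
        ((Polynomial.C (algebraMap E A c)) • Matrix.charmatrix N).det := by
      rw [Matrix.charpoly, ← Polynomial.coe_compRingHom_apply, RingHom.map_det]
      congr 1
      ext i j
      rcases eq_or_ne i j with rfl | hij
      · simp [Matrix.charmatrix_apply_eq, mul_sub, Matrix.smul_apply, Algebra.smul_def (A := A)]
      · simp [Matrix.charmatrix_apply_ne _ _ _ hij, Matrix.smul_apply, Algebra.smul_def (A := A)]
    rw [h1, Matrix.det_smul, Fintype.card_fin, map_pow, Matrix.charpoly]
  have hcoef : ∀ i < n, N.charpoly.coeff i = 0 := by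
    intro i hi
    have h1 := congrArg (fun q => Polynomial.coeff q i) hcomp
    simp only [Polynomial.comp_C_mul_X_coeff, hchar, Polynomial.coeff_C_mul] at h1
    have h2 : (c ^ n - c ^ i) • N.charpoly.coeff i = 0 := by
      rw [Algebra.smul_def, map_sub, map_pow, map_pow, sub_mul, ← h1]
      ring
    have h3 : c ^ n - c ^ i ≠ 0 := by
      obtain ⟨d, rfl⟩ := Nat.exists_eq_add_of_lt hi
      rw [add_assoc, pow_add, ← mul_sub_one]
      exact mul_ne_zero (pow_ne_zero _ hc0) (sub_ne_zero.2 (hc _ d.succ_ne_zero))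
    rw [← inv_smul_smul₀ h3 (N.charpoly.coeff i), h2, smul_zero]
  have hX : N.charpoly = Polynomial.X ^ n := by
    nontriviality A
    have hm := N.charpoly_monic
    have hd : N.charpoly.natDegree = n := by simp [N.charpoly_natDegree_eq_dim]
    rw [hm.as_sum, hd, Finset.sum_eq_zero fun i hi => ?_, add_zero]
    rw [hcoef i (Finset.mem_range.1 hi), map_zero, zero_mul]
  refine ⟨n, ?_⟩
  have := N.aeval_self_charpoly
  rwa [hX, map_pow, Polynomial.aeval_X] at this

end MatrixNilpotent

/-! ### The absolute value of the algebraic closure -/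

theorem coe_smul_integralClosure {K : Type*} [Field K] {O : ValuationSubring K} (σ : AbsGal K)
    (x : integralClosure O (AlgebraicClosure K)) :
    ((σ • x : integralClosure O (AlgebraicClosure K)) : AlgebraicClosure K) =
      σ (x : AlgebraicClosure K) := rfl

section LocalField

variable {K : Type*} [NontriviallyNormedField K] [IsUltrametricDist K] [CompleteSpace K]
  {O : ValuationSubring K}

local notation "ν" => spectralNorm K (AlgebraicClosure K)

/-- Multiplicativity of the spectral norm is where completeness of `K` enters. -/
theorem spectralNorm_mul_of_complete (x y : AlgebraicClosure K) : ν (x * y) = ν x * ν y :=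
  map_mul (spectralMulAlgNorm K (AlgebraicClosure K)) x y

variable (K) in
/-- The spectral norm of the algebraic closure as a homomorphism of monoids. -/
noncomputable def spectralNormHom : AlgebraicClosure K →*₀ ℝ where
  toFun := ν
  map_zero' := spectralNorm_zero
  map_one' := spectralNorm_one
  map_mul' := spectralNorm_mul_of_complete

theorem spectralNormHom_apply (x : AlgebraicClosure K) : spectralNormHom K x = ν x := rfl

omit [IsUltrametricDist K] [CompleteSpace K] in
theorem spectralNorm_pos_iff {x : AlgebraicClosure K} : 0 < ν x ↔ x ≠ 0 := by
  constructor
  · rintro h rfl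
    simp [spectralNorm_zero] at h
  · exact fun h => spectralNorm_zero_lt h (Algebra.IsAlgebraic.isAlgebraic x)

omit [CompleteSpace K] in
theorem spectralNorm_add_le (x y : AlgebraicClosure K) : ν (x + y) ≤ max (ν x) (ν y) :=
  isNonarchimedean_spectralNorm x y

omit [CompleteSpace K] in
theorem spectralNorm_sub_le (x y : AlgebraicClosure K) : ν (x - y) ≤ max (ν x) (ν y) := by
  rw [sub_eq_add_neg, ← spectralNorm_neg (K := K) (y := y) (Algebra.IsAlgebraic.isAlgebraic y)]
  exact spectralNorm_add_le x (-y)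

omit [IsUltrametricDist K] [CompleteSpace K] in
theorem isIntegral_iff_spectralNorm_le_one (hO : ∀ x : K, x ∈ O ↔ ‖x‖ ≤ 1)
    (x : AlgebraicClosure K) : IsIntegral O x ↔ ν x ≤ 1 := by
  have hx : IsIntegral K x := Algebra.IsIntegral.isIntegral x
  rw [spectralNorm, spectralValue_le_one_iff (minpoly.monic hx)]
  constructor
  · intro h n
    rw [minpoly.isIntegrallyClosed_eq_field_fractions' K h, Polynomial.coeff_map]
    exact (hO _).1 (Subtype.mem _)
  · intro h
    have hl : minpoly K x ∈ Polynomial.lifts (algebraMap O K) := by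
      rw [Polynomial.lifts_iff_coeff_lifts]
      exact fun n => ⟨⟨_, (hO _).2 (h n)⟩, rfl⟩
    obtain ⟨q, hq, -, hqm⟩ := Polynomial.lifts_and_degree_eq_and_monic hl (minpoly.monic hx)
    refine ⟨q, hqm, ?_⟩
    have := minpoly.aeval K x
    rw [← hq, Polynomial.aeval_map_algebraMap] at this
    exact this

theorem isUnit_integralClosure_iff (hO : ∀ x : K, x ∈ O ↔ ‖x‖ ≤ 1)
    (x : integralClosure O (AlgebraicClosure K)) :
    IsUnit x ↔ ν (x : AlgebraicClosure K) = 1 := by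
  constructor
  · rintro ⟨u, rfl⟩
    have h1 := (isIntegral_iff_spectralNorm_le_one hO _).1 (u : integralClosure O _).2
    have h2 := (isIntegral_iff_spectralNorm_le_one hO _).1 ((u⁻¹ : _ˣ) : integralClosure O _).2
    have h3 : ν ((u : integralClosure O (AlgebraicClosure K)) : AlgebraicClosure K) *
        ν (((u⁻¹ : _ˣ) : integralClosure O (AlgebraicClosure K)) : AlgebraicClosure K) = 1 := by
      rw [← spectralNorm_mul_of_complete, ← Subalgebra.coe_mul, Units.mul_inv]
      exact spectralNorm_one
    refine le_antisymm h1 ?_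
    nlinarith [spectralNorm_nonneg (K := K)
      ((u : integralClosure O (AlgebraicClosure K)) : AlgebraicClosure K)]
  · intro h
    have h0 : (x : AlgebraicClosure K) ≠ 0 := spectralNorm_pos_iff.1 (by rw [h]; exact one_pos)
    have hi : ν (x : AlgebraicClosure K)⁻¹ = 1 := by
      rw [← spectralNormHom_apply, map_inv₀, spectralNormHom_apply, h, inv_one]
    refine IsUnit.of_mul_eq_one
      ⟨(x : AlgebraicClosure K)⁻¹, (isIntegral_iff_spectralNorm_le_one hO _).2 hi.le⟩ ?_
    exact Subtype.ext (mul_inv_cancel₀ h0)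

/-- The nonunits of the integral closure are the elements of absolute value less than `1`. -/
theorem isLocalRing_integralClosure (hO : ∀ x : K, x ∈ O ↔ ‖x‖ ≤ 1) :
    IsLocalRing (integralClosure O (AlgebraicClosure K)) := by
  have key : ∀ x : integralClosure O (AlgebraicClosure K), x ∈ nonunits _ ↔
      ν (x : AlgebraicClosure K) < 1 := fun x => by
    rw [mem_nonunits_iff, isUnit_integralClosure_iff hO, lt_iff_le_and_ne]
    exact ⟨fun h => ⟨(isIntegral_iff_spectralNorm_le_one hO _).1 x.2, h⟩, fun h => h.2⟩
  refine IsLocalRing.of_nonunits_add fun a b ha hb => ?_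
  rw [key] at *
  exact (spectralNorm_add_le _ _).trans_lt (max_lt ha hb)

theorem mem_residueIdeal_iff (hO : ∀ x : K, x ∈ O ↔ ‖x‖ ≤ 1)
    (x : integralClosure O (AlgebraicClosure K)) :
    x ∈ residueIdeal O ↔ ν (x : AlgebraicClosure K) < 1 := by
  have := isLocalRing_integralClosure hO
  rw [residueIdeal, IsLocalRing.ringJacobson_eq_maximalIdeal, IsLocalRing.mem_maximalIdeal,
    mem_nonunits_iff, isUnit_integralClosure_iff hO, lt_iff_le_and_ne]
  exact ⟨fun h => ⟨(isIntegral_iff_spectralNorm_le_one hO _).1 x.2, h⟩, fun h => h.2⟩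

theorem isMaximal_residueIdeal (hO : ∀ x : K, x ∈ O ↔ ‖x‖ ≤ 1) : (residueIdeal O).IsMaximal := by
  have := isLocalRing_integralClosure hO
  rw [residueIdeal, IsLocalRing.ringJacobson_eq_maximalIdeal]
  infer_instance

omit [IsUltrametricDist K] [CompleteSpace K] in
theorem spectralNorm_absGal (σ : AbsGal K) (x : AlgebraicClosure K) : ν (σ x) = ν x :=
  (spectralNorm_eq_of_equiv σ x).symm

theorem mem_inertiaGroup_iff (hO : ∀ x : K, x ∈ O ↔ ‖x‖ ≤ 1) (σ : AbsGal K) :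
    σ ∈ inertiaGroup O ↔ ∀ x : AlgebraicClosure K, ν x ≤ 1 → ν (σ x - x) < 1 := by
  have key : ∀ x : integralClosure O (AlgebraicClosure K), σ • x - x ∈ residueIdeal O ↔
      ν (σ (x : AlgebraicClosure K) - x) < 1 := fun x => by
    rw [mem_residueIdeal_iff hO, Subalgebra.coe_sub, coe_smul_integralClosure]
  rw [inertiaGroup, Ideal.inertia, AddSubgroup.mem_inertia]
  refine ⟨fun h x hx => ?_, fun h x => ?_⟩
  · exact (key ⟨x, (isIntegral_iff_spectralNorm_le_one hO _).2 hx⟩).1 (h _)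
  · exact (key x).2 (h x ((isIntegral_iff_spectralNorm_le_one hO _).1 x.2))

theorem isArithFrobenius_iff (hO : ∀ x : K, x ∈ O ↔ ‖x‖ ≤ 1) (σ : AbsGal K) :
    IsArithFrobenius O σ ↔
      ∀ x : AlgebraicClosure K, ν x ≤ 1 → ν (σ x - x ^ residueCard O) < 1 := by
  have key : ∀ x : integralClosure O (AlgebraicClosure K),
      σ • x - x ^ residueCard O ∈ residueIdeal O ↔
        ν (σ (x : AlgebraicClosure K) - (x : AlgebraicClosure K) ^ residueCard O) < 1 := fun x => by
    rw [mem_residueIdeal_iff hO, Subalgebra.coe_sub, coe_smul_integralClosure, Subalgebra.coe_pow]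
  refine ⟨fun h x hx => ?_, fun h x => ?_⟩
  · exact (key ⟨x, (isIntegral_iff_spectralNorm_le_one hO _).2 hx⟩).1 (h _)
  · exact (key x).2 (h x ((isIntegral_iff_spectralNorm_le_one hO _).1 x.2))

/-- A finite extension `L` of a discretely valued field has a uniformizer: the powers of `‖L ˣ‖`
by the degree lie in the value group of `K`, so `‖L ˣ‖` is cyclic. -/
theorem exists_uniformizer {c : ℝ} (hc : 0 < c) (hK : ∀ x : K, x ≠ 0 → ∃ k : ℤ, ‖x‖ = c ^ k)
    (L : IntermediateField K (AlgebraicClosure K)) [FiniteDimensional K L] :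
    ∃ π : AlgebraicClosure K, π ∈ L ∧ π ≠ 0 ∧
      ∀ z ∈ L, z ≠ 0 → ∃ k : ℤ, ν z = ν π ^ k := by
  set n := Module.finrank K L
  have hn : n ≠ 0 := Module.finrank_pos.ne'
  set b : ℝ := c ^ (1 / n : ℝ)
  have hb : 0 < b := Real.rpow_pos_of_pos hc _
  have hbn : b ^ n = c := by
    simp only [b, one_div]
    exact Real.rpow_inv_natCast_pow hc.le hn
  have key : ∀ z ∈ L, z ≠ 0 → ∃ k : ℤ, ν z = b ^ k := by
    intro z hz h0
    have hint : IsIntegral K z := Algebra.IsIntegral.isIntegral z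
    set d := (minpoly K z).natDegree with hd
    have hd0 : d ≠ 0 := (minpoly.natDegree_pos hint).ne'
    have hdn : d ∣ n := by
      have h1 : d = (minpoly K (⟨z, hz⟩ : L)).natDegree := by
        rw [hd, ← minpoly.algebraMap_eq (algebraMap L (AlgebraicClosure K)).injective
          (⟨z, hz⟩ : L)]
        rfl
      rw [h1]
      exact minpoly.degree_dvd (Algebra.IsIntegral.isIntegral _)
    obtain ⟨k, hk⟩ := hK _ (minpoly.coeff_zero_ne_zero hint h0)
    obtain ⟨e, he⟩ := hdn
    have hz : ν z ^ d = c ^ k := by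
      rw [spectralNorm.spectralNorm_eq_norm_coeff_zero_rpow, ← hk, one_div]
      exact Real.rpow_inv_natCast_pow (norm_nonneg _) hd0
    refine ⟨k * e, ?_⟩
    refine (pow_left_inj₀ (spectralNorm_nonneg z) (zpow_pos hb _).le hd0).1 ?_
    rw [hz, ← hbn, ← zpow_natCast, ← zpow_natCast, ← zpow_mul, ← zpow_mul, he]
    congr 1
    push_cast
    ring
  let f : Lˣ →* ℝˣ := Units.map ((spectralNormHom K : AlgebraicClosure K →* ℝ).comp
    (algebraMap L (AlgebraicClosure K) : L →* AlgebraicClosure K))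
  have hf_apply : ∀ z : Lˣ, (f z : ℝ) = ν ((z : L) : AlgebraicClosure K) := fun _ => rfl
  have hf : f.range ≤ Subgroup.zpowers (Units.mk0 b hb.ne') := by
    rintro _ ⟨z, rfl⟩
    obtain ⟨k, hk⟩ := key (z : L) (z : L).2 (by simp)
    refine ⟨k, Units.ext ?_⟩
    rw [hf_apply, hk]
    simp
  have hcyc : IsCyclic f.range :=
    isCyclic_of_injective (Subgroup.inclusion hf) (Subgroup.inclusion_injective hf)
  obtain ⟨⟨_, π, rfl⟩, hg⟩ := hcyc.exists_generator
  refine ⟨(π : L), (π : L).2, by simp, fun z hz h0 => ?_⟩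
  have h0' : (⟨z, hz⟩ : L) ≠ 0 := fun h => h0 (congrArg Subtype.val h)
  obtain ⟨k, hk⟩ := hg ⟨f (Units.mk0 _ h0'), _, rfl⟩
  refine ⟨k, ?_⟩
  have := congrArg (fun u : f.range => ((u : ℝˣ) : ℝ)) hk
  simpa [hf_apply] using this.symm

/-- An inertia element whose order on a Galois-stable field `L` is invertible in the residue field
and whose tame character is trivial on `L` is trivial on `L`: otherwise `z = N x - ∑ γ ^ i x` has
trace zero under `γ`, although `∑ γ ^ i z` has the same absolute value as `N z`. -/
theorem eq_of_spectralNorm_sub_lt {γ : AbsGal K} {L : IntermediateField K (AlgebraicClosure K)}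
    (hL : ∀ z ∈ L, γ z ∈ L) {N : ℕ} (hN : ‖(N : K)‖ = 1)
    (hγN : ∀ z ∈ L, (γ ^ N) z = z) (hγ : ∀ z ∈ L, z ≠ 0 → ν (γ z - z) < ν z) :
    ∀ z ∈ L, γ z = z := by
  have hpowL : ∀ i : ℕ, ∀ z ∈ L, (γ ^ i) z ∈ L := by
    intro i
    induction i with
    | zero => simp
    | succ i ih => intro z hz; rw [pow_succ', AlgEquiv.mul_apply]; exact hL _ (ih z hz)
  have hpow : ∀ i : ℕ, ∀ z ∈ L, z ≠ 0 → ν ((γ ^ i) z - z) < ν z := by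
    intro i z hz h0
    induction i with
    | zero => simpa [spectralNorm_zero] using spectralNorm_pos_iff.2 h0
    | succ i ih =>
      have h1 : (γ ^ (i + 1)) z - z = γ ((γ ^ i) z - z) + (γ z - z) := by
        rw [pow_succ', AlgEquiv.mul_apply, map_sub]; ring
      rw [h1]
      refine (spectralNorm_add_le _ _).trans_lt (max_lt ?_ (hγ z hz h0))
      rwa [spectralNorm_absGal]
  have htr : ∀ x ∈ L, γ (∑ i ∈ Finset.range N, (γ ^ i) x) = ∑ i ∈ Finset.range N, (γ ^ i) x := by
    intro x hx
    have h1 : γ (∑ i ∈ Finset.range N, (γ ^ i) x) = ∑ i ∈ Finset.range N, (γ ^ (i + 1)) x := by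
      rw [map_sum]
      exact Finset.sum_congr rfl fun i _ => by rw [pow_succ', AlgEquiv.mul_apply]
    have h2 := Finset.sum_range_succ' (fun i => (γ ^ i) x) N
    rw [Finset.sum_range_succ, hγN x hx] at h2
    rw [h1]
    simpa using h2.symm
  intro x hx
  set T := ∑ i ∈ Finset.range N, (γ ^ i) x
  have hNx : (N : AlgebraicClosure K) * x = T := by
    by_contra hne
    set z := (N : AlgebraicClosure K) * x - T with hz
    have h0 : z ≠ 0 := sub_ne_zero.2 hne
    have hzL : z ∈ L := L.sub_mem (L.mul_mem (natCast_mem L N) hx)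
      (L.sum_mem fun i _ => hpowL i x hx)
    have hTfix : ∀ i : ℕ, (γ ^ i) T = T := by
      intro i
      induction i with
      | zero => simp
      | succ i ih => rw [pow_succ', AlgEquiv.mul_apply, ih, htr x hx]
    have hsum : ∑ i ∈ Finset.range N, (γ ^ i) z = 0 := by
      simp only [hz, map_sub, map_mul, map_natCast, hTfix, Finset.sum_sub_distrib,
        ← Finset.mul_sum, Finset.sum_const, Finset.card_range, nsmul_eq_mul]
      exact sub_self _
    have hNν : ν ((N : AlgebraicClosure K) * z) = ν z := by
      have : (N : AlgebraicClosure K) = algebraMap K _ (N : K) := by simp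
      rw [spectralNorm_mul_of_complete, this, spectralNorm_extends, hN, one_mul]
    have h1 : -((N : AlgebraicClosure K) * z) = ∑ i ∈ Finset.range N, ((γ ^ i) z - z) := by
      rw [Finset.sum_sub_distrib, hsum]
      simp
    have h2 : ∀ M : ℕ, ν (∑ i ∈ Finset.range M, ((γ ^ i) z - z)) < ν z := by
      intro M
      induction M with
      | zero => simpa [spectralNorm_zero] using spectralNorm_pos_iff.2 h0
      | succ M ih =>
        rw [Finset.sum_range_succ]
        exact (spectralNorm_add_le _ _).trans_lt (max_lt ih (hpow M z hzL h0))
    have h3 := h2 N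
    rw [← h1, spectralNorm_neg (Algebra.IsAlgebraic.isAlgebraic _), hNν] at h3
    exact lt_irrefl _ h3
  have hN0 : (N : AlgebraicClosure K) ≠ 0 := by
    have : (N : AlgebraicClosure K) = algebraMap K _ (N : K) := by simp
    rw [this, Ne, map_eq_zero, ← norm_eq_zero, hN]
    exact one_ne_zero
  refine mul_left_cancel₀ hN0 ?_
  have := htr x hx
  change γ T = T at this
  rwa [← hNx, map_mul, map_natCast] at this

end LocalField

/-! ### Tame characters of inertia -/

section Tame

variable {K : Type*} [NontriviallyNormedField K] [IsUltrametricDist K] [CompleteSpace K]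
  {O : ValuationSubring K}

local notation "ν" => spectralNorm K (AlgebraicClosure K)

theorem normal_inertiaGroup (hO : ∀ x : K, x ∈ O ↔ ‖x‖ ≤ 1) : (inertiaGroup O).Normal := by
  refine ⟨fun γ hγ σ => ?_⟩
  rw [mem_inertiaGroup_iff hO] at hγ ⊢
  intro x hx
  have h1 : (σ * γ * σ⁻¹) x - x = σ (γ (σ⁻¹ x) - σ⁻¹ x) := by
    rw [map_sub, AlgEquiv.mul_apply, AlgEquiv.mul_apply, ← AlgEquiv.mul_apply σ σ⁻¹,
      mul_inv_cancel, AlgEquiv.one_apply]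
  rw [h1, spectralNorm_absGal]
  exact hγ _ (by rwa [spectralNorm_absGal])

variable (K) in
/-- The elements of the algebraic closure that are congruent to `1` modulo the maximal ideal. -/
noncomputable def principalUnits : Subgroup (AlgebraicClosure K)ˣ where
  carrier := {a | ν ((a : AlgebraicClosure K) - 1) < 1}
  one_mem' := by simp [spectralNorm_zero]
  mul_mem' := by
    intro a b ha hb
    have h1 : ((a * b : (AlgebraicClosure K)ˣ) : AlgebraicClosure K) - 1 =
        (a - 1) * (b - 1) + ((a - 1) + (b - 1)) := by
      push_cast; ring
    have h2 : ν (((a : AlgebraicClosure K) - 1) * (b - 1)) < 1 := by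
      rw [spectralNorm_mul_of_complete]
      exact mul_lt_one_of_nonneg_of_lt_one_left (spectralNorm_nonneg _) ha (le_of_lt hb)
    rw [Set.mem_ofPred_eq, h1]
    exact (spectralNorm_add_le _ _).trans_lt
      (max_lt h2 ((spectralNorm_add_le _ _).trans_lt (max_lt ha hb)))
  inv_mem' := by
    intro a ha
    rw [Set.mem_ofPred_eq] at ha ⊢
    have ha1 : 1 ≤ ν (a : AlgebraicClosure K) := by
      by_contra hlt
      have h2 := spectralNorm_sub_le (a : AlgebraicClosure K) ((a : AlgebraicClosure K) - 1)
      rw [sub_sub_cancel, spectralNorm_one] at h2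
      exact absurd (h2.trans_lt (max_lt (not_le.1 hlt) ha)) (lt_irrefl _)
    have h1 : (a : AlgebraicClosure K) * (((a⁻¹ : (AlgebraicClosure K)ˣ) : AlgebraicClosure K) - 1)
        = -(a - 1) := by
      rw [mul_sub, Units.mul_inv]; ring
    have h2 := congrArg ν h1
    rw [spectralNorm_neg (Algebra.IsAlgebraic.isAlgebraic _), spectralNorm_mul_of_complete] at h2
    rw [← h2] at ha
    exact (le_mul_of_one_le_left (spectralNorm_nonneg _) ha1).trans_lt ha

theorem mem_principalUnits {a : (AlgebraicClosure K)ˣ} :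
    a ∈ principalUnits K ↔ ν ((a : AlgebraicClosure K) - 1) < 1 := Iff.rfl

theorem spectralNorm_div (x y : AlgebraicClosure K) : ν (x / y) = ν x / ν y :=
  map_div₀ (spectralNormHom K) x y

theorem spectralNorm_div_sub_one_lt {x y : AlgebraicClosure K} (hy : y ≠ 0) :
    ν (x / y - 1) < 1 ↔ ν (x - y) < ν y := by
  rw [div_sub_one hy, spectralNorm_div, div_lt_one (spectralNorm_pos_iff.2 hy)]

/-- If `π` is a uniformizer of `L`, an inertia element fixing `π` modulo higher order terms
fixes every element of `L` modulo higher order terms. -/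
theorem spectralNorm_sub_lt_of_uniformizer (hO : ∀ x : K, x ∈ O ↔ ‖x‖ ≤ 1) {γ : AbsGal K}
    (hγ : γ ∈ inertiaGroup O) {π z : AlgebraicClosure K} (hπ : π ≠ 0) (hz : z ≠ 0)
    {k : ℤ} (hk : ν z = ν π ^ k) (h : ν (γ π - π) < ν π) : ν (γ z - z) < ν z := by
  have hγ' : ∀ y : AlgebraicClosure K, y ≠ 0 → γ y ≠ 0 := fun y hy => by simpa using hy
  set u := z / π ^ k with hu
  have hu0 : u ≠ 0 := div_ne_zero hz (zpow_ne_zero _ hπ)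
  -- `u` is a unit, on which inertia acts trivially modulo the maximal ideal
  have hνu : ν u = 1 := by
    rw [hu, spectralNorm_div, hk, ← spectralNormHom_apply (π ^ k), map_zpow₀, spectralNormHom_apply,
      div_self]
    exact zpow_ne_zero _ (spectralNorm_pos_iff.2 hπ).ne'
  have h1 : Units.mk0 (γ π / π) (div_ne_zero (hγ' _ hπ) hπ) ∈ principalUnits K := by
    rw [mem_principalUnits]
    exact (spectralNorm_div_sub_one_lt hπ).2 h
  have h2 : Units.mk0 (γ u / u) (div_ne_zero (hγ' _ hu0) hu0) ∈ principalUnits K := by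
    rw [mem_principalUnits]
    refine (spectralNorm_div_sub_one_lt hu0).2 ?_
    rw [hνu]
    exact (mem_inertiaGroup_iff hO γ).1 hγ u hνu.le
  have h3 := mem_principalUnits.1 (mul_mem (zpow_mem h1 k) h2)
  rw [← spectralNorm_div_sub_one_lt hz]
  convert h3 using 3
  simp only [Units.val_mul, Units.val_zpow_eq_zpow_val, Units.val_mk0]
  rw [hu, map_div₀, map_zpow₀, div_zpow]
  have := zpow_ne_zero k hπ
  have := zpow_ne_zero k (hγ' _ hπ)
  field_simp

/-- The tame character `σ ↦ σ z / z` of the inertia group, with values in the residue field of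
the algebraic closure. -/
noncomputable def tameCharacter (hO : ∀ x : K, x ∈ O ↔ ‖x‖ ≤ 1) {z : AlgebraicClosure K}
    (hz : z ≠ 0) : inertiaGroup O →* integralClosure O (AlgebraicClosure K) ⧸ residueIdeal O where
  toFun σ := Ideal.Quotient.mk _ ⟨(σ : AbsGal K) z / z,
    (isIntegral_iff_spectralNorm_le_one hO _).2 (by
      rw [spectralNorm_div, spectralNorm_absGal, div_self (spectralNorm_pos_iff.2 hz).ne'])⟩
  map_one' := by
    rw [← map_one (Ideal.Quotient.mk (residueIdeal O))]
    congr 1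
    exact Subtype.ext (div_self hz)
  map_mul' := by
    intro σ τ
    rw [← map_mul, Ideal.Quotient.eq, mem_residueIdeal_iff hO]
    set u := (τ : AbsGal K) z / z with hu
    have hσz : (σ : AbsGal K) z ≠ 0 := by simpa using hz
    have hνu : ν u = 1 := by
      rw [hu, spectralNorm_div, spectralNorm_absGal, div_self (spectralNorm_pos_iff.2 hz).ne']
    have h1 : (((σ : AbsGal K) * τ : AbsGal K) z / z) - (σ : AbsGal K) z / z * u =
        ((σ : AbsGal K) u - u) * ((σ : AbsGal K) z / z) := by
      rw [sub_mul, mul_comm u, hu, map_div₀, AlgEquiv.mul_apply]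
      congr 1
      field_simp
    change ν ((((σ : AbsGal K) * τ : AbsGal K) z / z) - (σ : AbsGal K) z / z * u) < 1
    rw [h1, spectralNorm_mul_of_complete, spectralNorm_div, spectralNorm_absGal,
      div_self (spectralNorm_pos_iff.2 hz).ne', mul_one]
    exact (mem_inertiaGroup_iff hO _).1 σ.2 u hνu.le

theorem tameCharacter_eq_iff (hO : ∀ x : K, x ∈ O ↔ ‖x‖ ≤ 1) {z : AlgebraicClosure K}
    (hz : z ≠ 0) (σ τ : inertiaGroup O) : tameCharacter hO hz σ = tameCharacter hO hz τ ↔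
      ν ((σ : AbsGal K) z - (τ : AbsGal K) z) < ν z := by
  have h1 : ν ((σ : AbsGal K) z / z - (τ : AbsGal K) z / z) < 1 ↔
      ν ((σ : AbsGal K) z - (τ : AbsGal K) z) < ν z := by
    rw [← sub_div, spectralNorm_div, div_lt_one (spectralNorm_pos_iff.2 hz)]
  rw [← h1]
  exact Ideal.Quotient.eq.trans (mem_residueIdeal_iff hO _)

theorem tameCharacter_eq_one_iff (hO : ∀ x : K, x ∈ O ↔ ‖x‖ ≤ 1) {z : AlgebraicClosure K}
    (hz : z ≠ 0) (σ : inertiaGroup O) : tameCharacter hO hz σ = 1 ↔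
      ν ((σ : AbsGal K) z - z) < ν z := by
  rw [← map_one (tameCharacter hO hz), tameCharacter_eq_iff]
  rfl

/-- Conjugation by Frobenius raises the tame characters to the `q`-th power. -/
theorem tameCharacter_conj (hO : ∀ x : K, x ∈ O ↔ ‖x‖ ≤ 1) {z : AlgebraicClosure K}
    (hz : z ≠ 0) {φ : AbsGal K} (hφ : IsArithFrobenius O φ) (γ γ' : inertiaGroup O)
    (h : (γ' : AbsGal K) = φ * γ * φ⁻¹) :
    tameCharacter hO hz γ' = tameCharacter hO hz γ ^ residueCard O := by
  rw [isArithFrobenius_iff hO] at hφ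
  have hνz := (spectralNorm_pos_iff.2 hz).ne'
  have hφφ : φ (φ⁻¹ z) = z := by rw [← AlgEquiv.mul_apply, mul_inv_cancel, AlgEquiv.one_apply]
  set y := φ⁻¹ z with hy
  have hy0 : y ≠ 0 := by simpa [hy] using hz
  set u := (γ : AbsGal K) y / y with hu
  set a := (γ : AbsGal K) z / z with ha
  set v := y / z with hv
  have hv0 : v ≠ 0 := div_ne_zero hy0 hz
  have hνv : ν v = 1 := by
    rw [hv, spectralNorm_div, hy, spectralNorm_absGal, div_self hνz]
  have hνu : ν u = 1 := by
    rw [hu, spectralNorm_div, spectralNorm_absGal, div_self (spectralNorm_pos_iff.2 hy0).ne']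
  have hνa : ν a = 1 := by
    rw [ha, spectralNorm_div, spectralNorm_absGal, div_self hνz]
  have h1 : (γ' : AbsGal K) z / z = φ u := by
    rw [hu, map_div₀, hφφ, h, AlgEquiv.mul_apply, AlgEquiv.mul_apply]
  -- `u` and `a` are congruent, since the character of the unit `v` is trivial
  have hua : ν (u - a) < 1 := by
    have h2 : u - a = a * ((γ : AbsGal K) v / v - 1) := by
      have hγz : (γ : AbsGal K) z ≠ 0 := by simpa using hz
      rw [hu, ha, hv, map_div₀]
      field_simp
    rw [h2, spectralNorm_mul_of_complete, hνa, one_mul, spectralNorm_div_sub_one_lt hv0, hνv]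
    exact (mem_inertiaGroup_iff hO _).1 γ.2 v hνv.le
  have hu_int := (isIntegral_iff_spectralNorm_le_one hO u).2 hνu.le
  have ha_int := (isIntegral_iff_spectralNorm_le_one hO a).2 hνa.le
  have h3 : (Ideal.Quotient.mk (residueIdeal O) ⟨u, hu_int⟩) =
      Ideal.Quotient.mk (residueIdeal O) ⟨a, ha_int⟩ :=
    Ideal.Quotient.eq.2 ((mem_residueIdeal_iff hO _).2 hua)
  have h4 : tameCharacter hO hz γ = Ideal.Quotient.mk (residueIdeal O) ⟨a, ha_int⟩ := rfl
  rw [h4, ← h3, ← map_pow]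
  refine Ideal.Quotient.eq.2 ((mem_residueIdeal_iff hO _).2 ?_)
  change ν ((γ' : AbsGal K) z / z - u ^ residueCard O) < 1
  rw [h1]
  exact hφ u hνu.le

omit [IsUltrametricDist K] [CompleteSpace K] in
theorem exists_pow_restrictNormalHom_eq_one (L : IntermediateField K (AlgebraicClosure K))
    [FiniteDimensional K L] [Normal K L] :
    ∃ n : ℕ, n ≠ 0 ∧ ∀ σ : AbsGal K, AlgEquiv.restrictNormalHom L σ ^ n = 1 :=
  ⟨Nat.card (L ≃ₐ[K] L), Nat.card_pos.ne', fun _ => pow_card_eq_one'⟩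

omit [IsUltrametricDist K] [CompleteSpace K] in
theorem restrictNormalHom_eq_one_iff (L : IntermediateField K (AlgebraicClosure K))
    [Normal K L] (σ : AbsGal K) :
    AlgEquiv.restrictNormalHom L σ = 1 ↔ ∀ z ∈ L, σ z = z := by
  rw [← MonoidHom.mem_ker, IntermediateField.restrictNormalHom_ker,
    IntermediateField.mem_fixingSubgroup_iff]

/-- The kernel of the tame character of a uniformizer of `L` acts on `L` through a group whose
order is prime to every `p` that is invertible in the residue field. -/
theorem exists_coprime_pow_eq_one (hO : ∀ x : K, x ∈ O ↔ ‖x‖ ≤ 1) {p : ℕ} (hp : p.Prime)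
    (hpK : ‖(p : K)‖ = 1) (L : IntermediateField K (AlgebraicClosure K)) [FiniteDimensional K L]
    [Normal K L] {π : AlgebraicClosure K} (hπ : π ≠ 0)
    (hπL : ∀ z ∈ L, z ≠ 0 → ∃ k : ℤ, ν z = ν π ^ k) (γ : inertiaGroup O)
    (hγ : tameCharacter hO hπ γ = 1) :
    ∃ m : ℕ, m.Coprime p ∧ AlgEquiv.restrictNormalHom L (γ : AbsGal K) ^ m = 1 := by
  obtain ⟨n, hn, hpow⟩ := exists_pow_restrictNormalHom_eq_one L
  obtain ⟨a, m, hm, rfl⟩ := Nat.exists_eq_pow_mul_and_not_dvd hn p hp.ne_one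
  refine ⟨m, ((hp.coprime_iff_not_dvd).2 hm).symm, ?_⟩
  rw [← map_pow, restrictNormalHom_eq_one_iff]
  have hδ : tameCharacter hO hπ (γ ^ m) = 1 := by rw [map_pow, hγ, one_pow]
  rw [tameCharacter_eq_one_iff] at hδ
  refine eq_of_spectralNorm_sub_lt (N := p ^ a) (fun z hz => ?_) ?_ ?_ fun z hz h0 => ?_
  · have := (AlgEquiv.restrictNormalHom L ((γ : AbsGal K) ^ m) ⟨z, hz⟩).2
    rwa [AlgEquiv.restrictNormalHom_apply] at this
  · rw [Nat.cast_pow, norm_pow, hpK, one_pow]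
  · rw [← restrictNormalHom_eq_one_iff, map_pow, map_pow, ← pow_mul, mul_comm]
    exact hpow _
  · obtain ⟨k, hk⟩ := hπL z hz h0
    exact spectralNorm_sub_lt_of_uniformizer hO (γ ^ m).2 hπ h0 hk hδ

end Tame

/-! ### The tame `p`-adic quotient of inertia -/

section TameQuotient

theorem PadicInt.pow_dvd_of_coprime_mul {p : ℕ} [hp : Fact p.Prime] {m k : ℕ} (hm : m.Coprime p)
    {x : ℤ_[p]} (h : (p : ℤ_[p]) ^ k ∣ m * x) : (p : ℤ_[p]) ^ k ∣ x := by
  have h1 : IsCoprime (m : ℤ_[p]) ((p : ℤ_[p]) ^ k) := by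
    have := (Nat.isCoprime_iff_coprime.2 hm).map (Int.castRingHom ℤ_[p])
    exact IsCoprime.pow_right (by simpa using this)
  exact h1.symm.dvd_of_dvd_mul_left h

variable {K : Type*} [NontriviallyNormedField K] [IsUltrametricDist K] [CompleteSpace K]
  {O : ValuationSubring K} {p : ℕ} [hp : Fact p.Prime]
  {t : inertiaGroup O →* Multiplicative ℤ_[p]}

omit [IsUltrametricDist K] [CompleteSpace K] in
theorem exists_finite_normal_of_mem_nhds {U : Set (AbsGal K)} (hU : U ∈ nhds (1 : AbsGal K)) :
    ∃ L : IntermediateField K (AlgebraicClosure K),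
      ∃ (_ : FiniteDimensional K L) (_ : Normal K L),
      ∀ σ : AbsGal K, AlgEquiv.restrictNormalHom L σ = 1 → σ ∈ U := by
  obtain ⟨L, hL, hL', h⟩ := (krullTopology_mem_nhds_one_iff_of_normal K _ U).1 hU
  refine ⟨L, hL, hL', fun σ hσ => h ?_⟩
  rwa [SetLike.mem_coe, ← IntermediateField.restrictNormalHom_ker, MonoidHom.mem_ker]

omit [IsUltrametricDist K] [CompleteSpace K] in
theorem mem_nhds_one_of_restrictNormalHom (L : IntermediateField K (AlgebraicClosure K))
    [FiniteDimensional K L] [Normal K L] :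
    {σ : AbsGal K | AlgEquiv.restrictNormalHom L σ = 1} ∈ nhds (1 : AbsGal K) := by
  refine (krullTopology_mem_nhds_one_iff_of_normal K _ _).2 ⟨L, ‹_›, ‹_›, fun σ hσ => ?_⟩
  rwa [SetLike.mem_coe, ← IntermediateField.restrictNormalHom_ker, MonoidHom.mem_ker] at hσ

omit [IsUltrametricDist K] [CompleteSpace K] in
/-- The character `t` is locally divisible by any given power of `p`. -/
theorem exists_mem_nhds_pow_dvd (ht : Continuous t) (k : ℕ) :
    ∃ W ∈ nhds (1 : AbsGal K), ∀ γ : inertiaGroup O, (γ : AbsGal K) ∈ W →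
      (p : ℤ_[p]) ^ k ∣ (t γ).toAdd := by
  have hopen : IsOpen {x : ℤ_[p] | (p : ℤ_[p]) ^ k ∣ x} := by
    have : {x : ℤ_[p] | (p : ℤ_[p]) ^ k ∣ x} = Metric.ball 0 ((p : ℝ) ^ (-(k : ℤ) + 1)) := by
      ext x
      rw [Set.mem_ofPred_eq, mem_ball_zero_iff, ← PadicInt.norm_le_pow_iff_norm_lt_pow_add_one,
        PadicInt.norm_le_pow_iff_mem_span_pow, Ideal.mem_span_singleton]
    rw [this]
    exact Metric.isOpen_ball
  have h1 : Continuous fun γ : inertiaGroup O => (t γ).toAdd := continuous_toAdd.comp ht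
  have h2 : {γ : inertiaGroup O | (p : ℤ_[p]) ^ k ∣ (t γ).toAdd} ∈ nhds (1 : inertiaGroup O) :=
    (hopen.preimage h1).mem_nhds (by simp)
  rw [nhds_subtype, Filter.mem_comap] at h2
  obtain ⟨W, hW, h⟩ := h2
  exact ⟨W, hW, fun γ hγ => h hγ⟩

/-- Modulo an open normal subgroup, the inertia elements with `t` sufficiently divisible have order
prime to `p`. The reason is that a `p`-subgroup of a finite quotient of inertia embeds in the
multiplicative group of a field by a tame character, hence is cyclic, while a second direction
besides the one seen by `t` would make it noncyclic. -/
theorem exists_coprime_pow_restrictNormalHom (hO : ∀ x : K, x ∈ O ↔ ‖x‖ ≤ 1) {c : ℝ} (hc : 0 < c)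
    (hK : ∀ x : K, x ≠ 0 → ∃ k : ℤ, ‖x‖ = c ^ k) (hpK : ‖(p : K)‖ = 1) (ht : Continuous t)
    (ht' : Function.Surjective t) (L : IntermediateField K (AlgebraicClosure K))
    [FiniteDimensional K L] [Normal K L] :
    ∃ k : ℕ, ∀ γ : inertiaGroup O, (p : ℤ_[p]) ^ k ∣ (t γ).toAdd →
      ∃ m : ℕ, m.Coprime p ∧ AlgEquiv.restrictNormalHom L (γ : AbsGal K) ^ m = 1 := by
  have hmax := isMaximal_residueIdeal hO
  obtain ⟨n, hn, hpow⟩ := exists_pow_restrictNormalHom_eq_one L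
  obtain ⟨k, m₁, hm₁, rfl⟩ := Nat.exists_eq_pow_mul_and_not_dvd hn p hp.out.ne_one
  replace hm₁ : m₁.Coprime p := ((hp.out.coprime_iff_not_dvd).2 hm₁).symm
  obtain ⟨τ, hτ⟩ := ht' (Multiplicative.ofAdd 1)
  refine ⟨k + 1, fun γ hγ => ?_⟩
  -- a finite level `M` that sees both `L` and `t` modulo `p ^ (k + 1)`
  obtain ⟨W, hW, hWt⟩ := exists_mem_nhds_pow_dvd (O := O) (t := t) ht (k + 1)
  obtain ⟨M, hM, hM', hMW⟩ := exists_finite_normal_of_mem_nhds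
    (Filter.inter_mem hW (mem_nhds_one_of_restrictNormalHom L))
  obtain ⟨n', hn', hpow'⟩ := exists_pow_restrictNormalHom_eq_one M
  obtain ⟨a, m₂, hm₂, rfl⟩ := Nat.exists_eq_pow_mul_and_not_dvd hn' p hp.out.ne_one
  replace hm₂ : m₂.Coprime p := ((hp.out.coprime_iff_not_dvd).2 hm₂).symm
  obtain ⟨π, hπM, hπ, hπz⟩ := exists_uniformizer hc hK M
  set χ := tameCharacter hO hπ with hχ
  set μ := m₂ * m₁ with hμ
  have hμp : μ.Coprime p := Nat.Coprime.mul_left hm₂ hm₁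
  have hkill : ∀ σ : inertiaGroup O, χ (σ ^ μ) ^ p ^ a = 1 := by
    intro σ
    rw [← map_pow, hχ, tameCharacter_eq_one_iff]
    have h1 : AlgEquiv.restrictNormalHom M (((σ : AbsGal K) ^ μ) ^ p ^ a) = 1 := by
      rw [← pow_mul, map_pow, hμ, show m₂ * m₁ * p ^ a = p ^ a * m₂ * m₁ by ring, pow_mul, hpow' (σ : AbsGal K),
        one_pow]
    have h2 := (restrictNormalHom_eq_one_iff M _).1 h1 π hπM
    have h3 : (((σ ^ μ) ^ p ^ a : inertiaGroup O) : AbsGal K) π = π := h2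
    rw [h3, sub_self, spectralNorm_zero]
    exact spectralNorm_pos_iff.2 hπ
  -- elements with equal characters are congruent modulo `p ^ (k + 1)`, and up to prime-to-`p`
  -- torsion at level `L`
  have hker : ∀ δ : inertiaGroup O, χ δ = 1 → (p : ℤ_[p]) ^ (k + 1) ∣ (t δ).toAdd ∧
      ∃ m : ℕ, m.Coprime p ∧ AlgEquiv.restrictNormalHom L (δ : AbsGal K) ^ m = 1 := by
    intro δ hδ
    obtain ⟨m, hm, h⟩ := exists_coprime_pow_eq_one hO hp.out hpK M hπ hπz δ hδ
    rw [← map_pow] at h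
    have hmem := hMW _ h
    refine ⟨PadicInt.pow_dvd_of_coprime_mul hm ?_, m, hm, ?_⟩
    · have := hWt (δ ^ m) hmem.1
      rwa [map_pow, toAdd_pow, nsmul_eq_mul] at this
    · rw [← map_pow]; exact hmem.2
  have hrel : ∀ (σ₁ σ₂ : inertiaGroup O) (j : ℕ), χ (σ₁ ^ μ) = χ (σ₂ ^ μ) ^ j →
      (p : ℤ_[p]) ^ (k + 1) ∣ (t σ₁).toAdd - j * (t σ₂).toAdd ∧
      ∃ m : ℕ, m.Coprime p ∧
        AlgEquiv.restrictNormalHom L ((σ₁ ^ μ * ((σ₂ ^ μ) ^ j)⁻¹ : inertiaGroup O) : AbsGal K) ^ m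
          = 1 := by
    intro σ₁ σ₂ j hj
    have h1 : χ (σ₁ ^ μ * ((σ₂ ^ μ) ^ j)⁻¹) = 1 := by
      rw [map_mul, hj, ← map_pow, ← map_mul, mul_inv_cancel, map_one]
    obtain ⟨h2, h3⟩ := hker _ h1
    refine ⟨PadicInt.pow_dvd_of_coprime_mul hμp ?_, h3⟩
    convert h2 using 1
    simp only [map_mul, map_inv, map_pow, toAdd_mul, toAdd_inv, toAdd_pow, nsmul_eq_mul]
    ring
  have hτ1 : (t τ).toAdd = 1 := by rw [hτ]; rfl
  obtain ⟨α, hα, hα'⟩ := (Nat.dvd_prime_pow hp.out).1 (orderOf_dvd_of_pow_eq_one (hkill γ))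
  obtain ⟨β, hβ, hβ'⟩ := (Nat.dvd_prime_pow hp.out).1 (orderOf_dvd_of_pow_eq_one (hkill τ))
  rcases le_total α β with hαβ | hβα
  · have hprim : IsPrimitiveRoot (χ (τ ^ μ)) (p ^ β) := hβ' ▸ IsPrimitiveRoot.orderOf _
    have hone : χ (γ ^ μ) ^ p ^ β = 1 := by
      rw [← Nat.add_sub_cancel' hαβ, pow_add, pow_mul, ← hα', pow_orderOf_eq_one, one_pow]
    have : NeZero (p ^ β) := ⟨pow_ne_zero _ hp.out.ne_zero⟩
    obtain ⟨j, -, hj⟩ := hprim.eq_pow_of_pow_eq_one hone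
    obtain ⟨h1, m, hm, h2⟩ := hrel γ τ j hj.symm
    rw [hτ1, mul_one] at h1
    have h3 : (p : ℤ_[p]) ^ k ∣ (j : ℤ) := by
      have := dvd_sub hγ h1
      rw [sub_sub_cancel] at this
      exact_mod_cast (pow_dvd_pow _ k.le_succ).trans this
    rw [PadicInt.pow_p_dvd_int_iff] at h3
    obtain ⟨i, rfl⟩ : p ^ k ∣ j := by exact_mod_cast h3
    have h4 : AlgEquiv.restrictNormalHom L (((τ ^ μ) ^ (p ^ k * i) : inertiaGroup O) : AbsGal K)
        = 1 := by
      have h5 : (τ ^ μ) ^ (p ^ k * i) = (τ ^ (p ^ k * m₁)) ^ (m₂ * i) := by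
        rw [← pow_mul, ← pow_mul, hμ]
        congr 1
        ring
      rw [h5, Subgroup.coe_pow, Subgroup.coe_pow, map_pow, map_pow, hpow, one_pow]
    refine ⟨μ * m, Nat.Coprime.mul_left hμp hm, ?_⟩
    rw [Subgroup.coe_mul, Subgroup.coe_inv, map_mul, map_inv, h4, inv_one, mul_one,
      Subgroup.coe_pow, map_pow, ← pow_mul] at h2
    exact h2
  · exfalso
    have hprim : IsPrimitiveRoot (χ (γ ^ μ)) (p ^ α) := hα' ▸ IsPrimitiveRoot.orderOf _
    have hone : χ (τ ^ μ) ^ p ^ α = 1 := by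
      rw [← Nat.add_sub_cancel' hβα, pow_add, pow_mul, ← hβ', pow_orderOf_eq_one, one_pow]
    have : NeZero (p ^ α) := ⟨pow_ne_zero _ hp.out.ne_zero⟩
    obtain ⟨j, -, hj⟩ := hprim.eq_pow_of_pow_eq_one hone
    -- `t τ = 1` would be a multiple of `t γ` modulo `p`
    obtain ⟨h1, -⟩ := hrel τ γ j hj.symm
    rw [hτ1] at h1
    have h2 : (p : ℤ_[p]) ∣ 1 := by
      have hpp : (p : ℤ_[p]) ∣ (p : ℤ_[p]) ^ (k + 1) := dvd_pow_self _ k.succ_ne_zero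
      have := dvd_add (hpp.trans h1) ((hpp.trans hγ).mul_left j)
      rwa [sub_add_cancel] at this
    exact PadicInt.prime_p.not_isUnit (isUnit_of_dvd_one h2)

/-- Frobenius acts on the tame quotient by multiplication by `q`. -/
theorem toAdd_conj_arithFrobenius (hO : ∀ x : K, x ∈ O ↔ ‖x‖ ≤ 1) {c : ℝ} (hc : 0 < c)
    (hK : ∀ x : K, x ≠ 0 → ∃ k : ℤ, ‖x‖ = c ^ k) (hpK : ‖(p : K)‖ = 1) (ht : Continuous t)
    {φ : AbsGal K} (hφ : IsArithFrobenius O φ) (γ γ' : inertiaGroup O)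
    (h : (γ' : AbsGal K) = φ * γ * φ⁻¹) : (t γ').toAdd = residueCard O * (t γ).toAdd := by
  have key : ∀ k : ℕ, (p : ℤ_[p]) ^ k ∣ (t γ').toAdd - residueCard O * (t γ).toAdd := by
    intro k
    obtain ⟨W, hW, hWt⟩ := exists_mem_nhds_pow_dvd (O := O) (t := t) ht k
    obtain ⟨M, hM, hM', hMW⟩ := exists_finite_normal_of_mem_nhds hW
    obtain ⟨π, hπM, hπ, hπz⟩ := exists_uniformizer hc hK M
    have h1 : tameCharacter hO hπ (γ' * (γ ^ residueCard O)⁻¹) = 1 := by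
      rw [map_mul, tameCharacter_conj hO hπ hφ γ γ' h, ← map_pow, ← map_mul, mul_inv_cancel,
        map_one]
    obtain ⟨m, hm, h2⟩ := exists_coprime_pow_eq_one hO hp.out hpK M hπ hπz _ h1
    rw [← map_pow] at h2
    refine PadicInt.pow_dvd_of_coprime_mul hm ?_
    convert hWt ((γ' * (γ ^ residueCard O)⁻¹) ^ m) (hMW _ h2) using 1
    simp only [map_mul, map_inv, map_pow, toAdd_mul, toAdd_inv, toAdd_pow, nsmul_eq_mul]
    ring
  refine sub_eq_zero.1 (norm_le_zero_iff.1 ?_)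
  have hlim : Filter.Tendsto (fun k : ℕ => (p : ℝ) ^ (-(k : ℤ))) Filter.atTop (nhds 0) := by
    simp only [zpow_neg, zpow_natCast, ← inv_pow]
    exact tendsto_pow_atTop_nhds_zero_of_lt_one (by positivity)
      (inv_lt_one_of_one_lt₀ (by exact_mod_cast hp.out.one_lt))
  exact ge_of_tendsto' hlim fun k => (PadicInt.norm_le_pow_iff_mem_span_pow _ k).2
    (Ideal.mem_span_singleton.2 (key k))

end TameQuotient

/-! ### Existence of Frobenius elements -/

section Frobenius

variable {K : Type*} [NontriviallyNormedField K] [IsUltrametricDist K] [CompleteSpace K]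
  {O : ValuationSubring K}

/-- The `q`-power automorphism of the residue field of the algebraic closure lifts to the Galois group,
which is profinite and has `O` as its ring of invariants. -/
theorem exists_isArithFrobenius [PerfectField K] [Finite (IsLocalRing.ResidueField O)]
    (hO : ∀ x : K, x ∈ O ↔ ‖x‖ ≤ 1) : ∃ φ : AbsGal K, IsArithFrobenius O φ := by
  have hmax := isMaximal_residueIdeal hO
  have : IsGalois K (AlgebraicClosure K) := inferInstance
  let _ : TopologicalSpace (integralClosure O (AlgebraicClosure K)) := ⊥
  have : DiscreteTopology (integralClosure O (AlgebraicClosure K)) := ⟨rfl⟩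
  have : ContinuousSMul (AbsGal K) (integralClosure O (AlgebraicClosure K)) := by
    refine continuousSMul_iff_stabilizer_isOpen.2 fun x => ?_
    have hfin : FiniteDimensional K
        (IntermediateField.adjoin K {(x : AlgebraicClosure K)}) :=
      IntermediateField.adjoin.finiteDimensional (Algebra.IsIntegral.isIntegral _)
    refine Subgroup.isOpen_mono (fun σ hσ => ?_) (IntermediateField.fixingSubgroup_isOpen
      (IntermediateField.adjoin K {(x : AlgebraicClosure K)}))
    rw [MulAction.mem_stabilizer_iff]
    exact Subtype.ext ((IntermediateField.mem_fixingSubgroup_iff _ _).1 hσ _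
      (IntermediateField.mem_adjoin_simple_self K _))
  have : Algebra.IsInvariant O (integralClosure O (AlgebraicClosure K)) (AbsGal K) := by
    refine ⟨fun b hb => ?_⟩
    have h1 : (b : AlgebraicClosure K) ∈ Set.range (algebraMap K (AlgebraicClosure K)) := by
      rw [InfiniteGalois.mem_range_algebraMap_iff_fixed]
      exact fun σ => congrArg Subtype.val (hb σ)
    obtain ⟨a, ha⟩ := h1
    have h2 : a ∈ O := by
      rw [hO, ← spectralNorm_extends (L := AlgebraicClosure K) a, ha]
      exact (isIntegral_iff_spectralNorm_le_one hO _).1 b.2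
    exact ⟨⟨a, h2⟩, Subtype.ext ha⟩
  have : (residueIdeal O).LiesOver (IsLocalRing.maximalIdeal O) := by
    have : ((residueIdeal O).under O).IsMaximal :=
      Ideal.isMaximal_comap_of_isIntegral_of_isMaximal (residueIdeal O)
    exact ⟨(IsLocalRing.eq_maximalIdeal this).symm⟩
  let _ : Field (O ⧸ IsLocalRing.maximalIdeal O) := Ideal.Quotient.field _
  let _ : Field (integralClosure O (AlgebraicClosure K) ⧸ residueIdeal O) := Ideal.Quotient.field _
  have : Finite (O ⧸ IsLocalRing.maximalIdeal O) := ‹Finite (IsLocalRing.ResidueField O)›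
  let _ : Fintype (O ⧸ IsLocalRing.maximalIdeal O) := Fintype.ofFinite _
  have : Algebra.IsIntegral (O ⧸ IsLocalRing.maximalIdeal O)
      (integralClosure O (AlgebraicClosure K) ⧸ residueIdeal O) :=
    Ideal.Quotient.algebra_isIntegral_of_liesOver _ _
  have : Algebra.IsAlgebraic (O ⧸ IsLocalRing.maximalIdeal O)
      (integralClosure O (AlgebraicClosure K) ⧸ residueIdeal O) :=
    Algebra.IsIntegral.isAlgebraic
  obtain ⟨φ, hφ⟩ := Ideal.Quotient.stabilizerHom_surjective_of_profinite (G := AbsGal K)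
    (IsLocalRing.maximalIdeal O) (residueIdeal O)
    (FiniteField.frobeniusAlgEquivOfAlgebraic (O ⧸ IsLocalRing.maximalIdeal O)
      (integralClosure O (AlgebraicClosure K) ⧸ residueIdeal O))
  refine ⟨φ, fun x => ?_⟩
  have h1 := DFunLike.congr_fun hφ (Ideal.Quotient.mk (residueIdeal O) x)
  have hcard : Fintype.card (O ⧸ IsLocalRing.maximalIdeal O) = residueCard O := by
    rw [← Nat.card_eq_fintype_card]; rfl
  rw [Ideal.Quotient.stabilizerHom_apply, FiniteField.coe_frobeniusAlgEquivOfAlgebraic,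
    hcard] at h1
  exact Ideal.Quotient.eq.1 (h1.trans (map_pow _ _ _).symm)

end Frobenius

/-! ### Small logarithms and the existence of the monodromy operator -/

section UnitBalls

theorem Subgroup.mem_of_pow_mem_of_coprime {G : Type*} [Group G] (H : Subgroup G) {g : G} {a b : ℕ}
    (hab : a.Coprime b) (ha : g ^ a ∈ H) (hb : g ^ b ∈ H) : g ∈ H := by
  have h1 : g = (g ^ a) ^ a.gcdA b * (g ^ b) ^ a.gcdB b := by
    rw [← zpow_natCast, ← zpow_natCast, ← zpow_mul, ← zpow_mul, ← zpow_add, ← Nat.gcd_eq_gcd_ab,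
      hab.gcd_eq_one, Nat.cast_one, zpow_one]
  rw [h1]
  exact H.mul_mem (H.zpow_mem ha _) (H.zpow_mem hb _)

variable {B : Type*} [NormedRing B] [IsUltrametricDist B]

variable (B) in
/-- The units of an ultrametric ring that are at distance at most `ε` from `1`. -/
def unitBall (ε : ℝ) (h0 : 0 < ε) (h1 : ε < 1) : Subgroup Bˣ where
  carrier := {g | ‖(g : B) - 1‖ ≤ ε}
  one_mem' := by simpa using h0.le
  mul_mem' := by
    intro a b ha hb
    have h2 : ((a * b : Bˣ) : B) - 1 = (a - 1) * (b - 1) + ((a - 1) + (b - 1)) := by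
      push_cast; noncomm_ring
    have h3 : ‖((a : B) - 1) * (b - 1)‖ ≤ ε :=
      (norm_mul_le _ _).trans ((mul_le_of_le_one_right (norm_nonneg _) (le_trans hb h1.le)).trans ha)
    change ‖((a * b : Bˣ) : B) - 1‖ ≤ ε
    rw [h2]
    exact (IsUltrametricDist.norm_add_le_max _ _).trans
      (max_le h3 ((IsUltrametricDist.norm_add_le_max _ _).trans (max_le ha hb)))
  inv_mem' := by
    intro a ha
    change ‖(a : B) - 1‖ ≤ ε at ha
    change ‖((a⁻¹ : Bˣ) : B) - 1‖ ≤ ε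
    have h2 : ((a⁻¹ : Bˣ) : B) - 1 = -((a - 1) * ((a⁻¹ : Bˣ) - 1)) + -(a - 1) := by
      have := a.mul_inv
      rw [sub_mul, mul_sub, this]
      noncomm_ring
    by_contra! hlt
    have h3 := IsUltrametricDist.norm_add_le_max (-(((a : B) - 1) * (((a⁻¹ : Bˣ) : B) - 1)))
      (-((a : B) - 1))
    rw [← h2, norm_neg, norm_neg] at h3
    rcases le_max_iff.1 h3 with h | h
    · have h4 := h.trans (norm_mul_le _ _)
      nlinarith
    · linarith

theorem mem_unitBall {ε : ℝ} {h0 : 0 < ε} {h1 : ε < 1} {g : Bˣ} :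
    g ∈ unitBall B ε h0 h1 ↔ ‖(g : B) - 1‖ ≤ ε := Iff.rfl

theorem unitBall_mem_nhds {ε : ℝ} (h0 : 0 < ε) (h1 : ε < 1) :
    (unitBall B ε h0 h1 : Set Bˣ) ∈ nhds (1 : Bˣ) := by
  have h2 : Metric.closedBall (1 : B) ε ∈ nhds ((1 : Bˣ) : B) := Metric.closedBall_mem_nhds _ h0
  filter_upwards [Units.continuous_val.tendsto (1 : Bˣ) h2] with g hg
  rwa [Set.mem_preimage, mem_closedBall_iff_norm] at hg

/-- A small ball around `1` is pro-`p`: in it, elements whose order modulo a smaller ball is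
prime to `p` lie in the smaller ball. -/
theorem mem_unitBall_of_coprime_pow {p : ℕ} [hp : Fact p.Prime] (E : Type*) [NormedField E]
    [NormedAlgebra ℚ_[p] E] [NormedAlgebra E B] {ε : ℝ} (h0 : 0 < ε) (h1 : ε < 1) {g : Bˣ}
    (hg : ‖(g : B) - 1‖ < (p : ℝ)⁻¹) {m : ℕ} (hm : m.Coprime p)
    (h : g ^ m ∈ unitBall B ε h0 h1) : g ∈ unitBall B ε h0 h1 := by
  have hlim : Filter.Tendsto (fun j : ℕ => (p : ℝ)⁻¹ ^ j * ‖(g : B) - 1‖) Filter.atTop (nhds 0) := by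
    rw [← zero_mul ‖(g : B) - 1‖]
    exact (tendsto_pow_atTop_nhds_zero_of_lt_one (by positivity)
      (inv_lt_one_of_one_lt₀ (by exact_mod_cast hp.out.one_lt))).mul_const _
  obtain ⟨j, hj⟩ := (hlim.eventually (gt_mem_nhds h0)).exists
  refine Subgroup.mem_of_pow_mem_of_coprime _ (hm.pow_right j) h ?_
  rw [mem_unitBall, Units.val_pow_eq_pow_val, norm_pow_prime_pow_sub_one E hg]
  exact hj.le

end UnitBalls

section Monodromy

variable {K : Type*} [NontriviallyNormedField K] [IsUltrametricDist K] [CompleteSpace K]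
  {O : ValuationSubring K} {p : ℕ} [hp : Fact p.Prime]

/-- The character `t` with values in the coefficient field. -/
noncomputable def coeffCharacter (E : Type*) [NormedField E] [NormedAlgebra ℚ_[p] E]
    (t : inertiaGroup O →* Multiplicative ℤ_[p]) (γ : inertiaGroup O) : E :=
  algebraMap ℚ_[p] E ((t γ).toAdd : ℚ_[p])

variable {E : Type*} [NormedField E] [NormedAlgebra ℚ_[p] E]
  (t : inertiaGroup O →* Multiplicative ℤ_[p])

omit [IsUltrametricDist K] [CompleteSpace K] in
theorem coeffCharacter_mul (γ δ : inertiaGroup O) :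
    coeffCharacter E t (γ * δ) = coeffCharacter E t γ + coeffCharacter E t δ := by
  simp [coeffCharacter]

omit [IsUltrametricDist K] [CompleteSpace K] in
theorem coeffCharacter_inv (γ : inertiaGroup O) :
    coeffCharacter E t γ⁻¹ = -coeffCharacter E t γ := by
  simp [coeffCharacter]

variable {t}

omit [IsUltrametricDist K] [CompleteSpace K] in
theorem exists_pow_mem_of_mem_nhds {U : Set (AbsGal K)} (hU : U ∈ nhds (1 : AbsGal K)) :
    ∃ n : ℕ, n ≠ 0 ∧ ∀ σ : AbsGal K, σ ^ n ∈ U := by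
  obtain ⟨L, _, _, h⟩ := exists_finite_normal_of_mem_nhds hU
  obtain ⟨n, hn, hpow⟩ := exists_pow_restrictNormalHom_eq_one L
  exact ⟨n, hn, fun σ => h _ (by rw [map_pow, hpow])⟩

omit [IsUltrametricDist K] [CompleteSpace K] in
/-- A property holds on an open subgroup of inertia if and only if it holds for the inertia elements in
some neighbourhood of the identity of the Galois group. -/
theorem exists_openSubgroup_inertia_iff {P : inertiaGroup O → Prop} :
    (∃ J : OpenSubgroup (inertiaGroup O), ∀ γ ∈ J, P γ) ↔
      ∃ U ∈ nhds (1 : AbsGal K), ∀ γ : inertiaGroup O, (γ : AbsGal K) ∈ U → P γ := by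
  constructor
  · rintro ⟨J, hJ⟩
    have h1 : (J : Set (inertiaGroup O)) ∈ nhds (1 : inertiaGroup O) := J.mem_nhds_one
    rw [nhds_subtype, Filter.mem_comap] at h1
    obtain ⟨U, hU, h⟩ := h1
    exact ⟨U, hU, fun γ hγ => hJ γ (h hγ)⟩
  · rintro ⟨U, hU, h⟩
    obtain ⟨L, _, _, hL⟩ := exists_finite_normal_of_mem_nhds hU
    refine ⟨⟨(AlgEquiv.restrictNormalHom L).ker.comap (inertiaGroup O).subtype, ?_⟩,
      fun γ hγ => h γ (hL _ hγ)⟩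
    have h1 : IsOpen ((AlgEquiv.restrictNormalHom L : AbsGal K →* L ≃ₐ[K] L).ker :
        Set (AbsGal K)) := by
      rw [IntermediateField.restrictNormalHom_ker]
      exact IntermediateField.fixingSubgroup_isOpen L
    exact h1.preimage continuous_subtype_val

section Representation

variable {B : Type*} [NormedRing B] [NormedAlgebra E B] [IsUltrametricDist B]
  {ρ : AbsGal K →* Bˣ}

variable (E) in
include E in
/-- On the inertia elements acting close to the identity, `ρ` depends only on `t`, and does so
continuously. -/
theorem exists_forall_mem_unitBall (hO : ∀ x : K, x ∈ O ↔ ‖x‖ ≤ 1) {c : ℝ} (hc : 0 < c)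
    (hK : ∀ x : K, x ≠ 0 → ∃ k : ℤ, ‖x‖ = c ^ k) (hpK : ‖(p : K)‖ = 1) (ht : Continuous t)
    (ht' : Function.Surjective t) (hρ : Continuous ρ) {ε : ℝ} (h0 : 0 < ε) (h1 : ε < 1) :
    ∃ k : ℕ, ∀ γ : inertiaGroup O, ‖(ρ γ : B) - 1‖ < (p : ℝ)⁻¹ →
      (p : ℤ_[p]) ^ k ∣ (t γ).toAdd → ρ γ ∈ unitBall B ε h0 h1 := by
  have hU : ρ ⁻¹' (unitBall B ε h0 h1) ∈ nhds (1 : AbsGal K) :=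
    hρ.continuousAt.preimage_mem_nhds (by rw [map_one]; exact unitBall_mem_nhds h0 h1)
  obtain ⟨L, _, _, hL⟩ := exists_finite_normal_of_mem_nhds hU
  obtain ⟨k, hk⟩ := exists_coprime_pow_restrictNormalHom hO hc hK hpK ht ht' L
  refine ⟨k, fun γ hγ hγt => ?_⟩
  obtain ⟨m, hm, h2⟩ := hk γ hγt
  rw [← map_pow] at h2
  have h3 := hL _ h2
  rw [Set.mem_preimage, map_pow] at h3
  exact mem_unitBall_of_coprime_pow E h0 h1 hγ hm h3

variable (E) in
include E in
/-- `ρ` kills the inertia elements in the kernel of `t` that it sends close to the identity. -/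
theorem eq_one_of_toAdd_eq_zero (hO : ∀ x : K, x ∈ O ↔ ‖x‖ ≤ 1) {c : ℝ} (hc : 0 < c)
    (hK : ∀ x : K, x ≠ 0 → ∃ k : ℤ, ‖x‖ = c ^ k) (hpK : ‖(p : K)‖ = 1) (ht : Continuous t)
    (ht' : Function.Surjective t) (hρ : Continuous ρ) {γ : inertiaGroup O}
    (hγ : ‖(ρ γ : B) - 1‖ < (p : ℝ)⁻¹) (hγt : (t γ).toAdd = 0) : ρ γ = 1 := by
  refine Units.ext (sub_eq_zero.1 (norm_le_zero_iff.1 (le_of_forall_pos_lt_add fun ε hε => ?_)))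
  have h0 : 0 < min (ε / 2) (1 / 2) := by positivity
  have h1 : min (ε / 2) (1 / 2) < 1 := (min_le_right _ _).trans_lt (by norm_num)
  obtain ⟨k, hk⟩ := exists_forall_mem_unitBall E hO hc hK hpK ht ht' hρ h0 h1
  have h2 := mem_unitBall.1 (hk γ hγ (by rw [hγt]; exact dvd_zero _))
  have h3 := h2.trans (min_le_left _ _)
  change ‖(ρ γ : B) - 1‖ < 0 + ε
  linarith

/-- The logarithm of `ρ γ`, for an inertia element `γ` close to the identity, is scaled by `q` under
conjugation by Frobenius. -/
theorem exists_hasPadicLog_rep [CompleteSpace B] (hO : ∀ x : K, x ∈ O ↔ ‖x‖ ≤ 1) {c : ℝ}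
    (hc : 0 < c) (hK : ∀ x : K, x ≠ 0 → ∃ k : ℤ, ‖x‖ = c ^ k) (hpK : ‖(p : K)‖ = 1)
    (ht : Continuous t) (ht' : Function.Surjective t) (hρ : Continuous ρ) {φ : AbsGal K}
    (hφ : IsArithFrobenius O φ) :
    ∃ (γ : inertiaGroup O) (n : ℕ) (x : B), n ≠ 0 ∧ (t γ).toAdd = n ∧
      ‖(ρ γ : B) - 1‖ < (p : ℝ)⁻¹ ∧ HasPadicLog p E (ρ γ : B) x ∧
      (ρ φ : B) * x * ((ρ φ)⁻¹ : Bˣ) = (residueCard O : E) • x := by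
  have hp0 : 0 < (p : ℝ)⁻¹ := inv_pos.2 (by exact_mod_cast hp.out.pos)
  have hp1 : (p : ℝ)⁻¹ < 1 := inv_lt_one_of_one_lt₀ (by exact_mod_cast hp.out.one_lt)
  have h0 : 0 < (p : ℝ)⁻¹ / 2 := by positivity
  have h1 : (p : ℝ)⁻¹ / 2 < 1 := by linarith
  have hU : ρ ⁻¹' (unitBall B _ h0 h1) ∈ nhds (1 : AbsGal K) :=
    hρ.continuousAt.preimage_mem_nhds (by rw [map_one]; exact unitBall_mem_nhds h0 h1)
  obtain ⟨n, hn, hpow⟩ := exists_pow_mem_of_mem_nhds hU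
  obtain ⟨τ, hτ⟩ := ht' (Multiplicative.ofAdd 1)
  have hlt : ∀ g ∈ unitBall B _ h0 h1, ‖(g : B) - 1‖ < (p : ℝ)⁻¹ := fun g hg =>
    (mem_unitBall.1 hg).trans_lt (by linarith)
  have hγ : ‖(ρ (τ ^ n : inertiaGroup O) : B) - 1‖ < (p : ℝ)⁻¹ := hlt _ (hpow _)
  obtain ⟨x, hx⟩ := exists_hasPadicLog (p := p) (E := E) hγ
  refine ⟨τ ^ n, n, x, hn, by rw [map_pow, hτ]; simp, hγ, hx, ?_⟩
  have hnorm := normal_inertiaGroup hO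
  set γ := τ ^ n with hγdef
  let γ' : inertiaGroup O := ⟨φ * γ * φ⁻¹, hnorm.conj_mem _ γ.2 φ⟩
  have hγ' : (γ' : AbsGal K) = φ * γ * φ⁻¹ := rfl
  have h2 : (t (γ' * (γ ^ residueCard O)⁻¹)).toAdd = 0 := by
    simp only [map_mul, map_inv, map_pow, toAdd_mul, toAdd_inv, toAdd_pow, nsmul_eq_mul]
    rw [toAdd_conj_arithFrobenius hO hc hK hpK ht hφ γ γ' hγ', add_neg_cancel]
  have h3 : ρ γ' ∈ unitBall B _ h0 h1 := by
    have : (γ' : AbsGal K) = (φ * τ * φ⁻¹) ^ n := by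
      rw [conj_pow, hγ', hγdef, Subgroup.coe_pow]
    rw [this]
    exact hpow _
  have h4 : ρ γ' * (ρ γ ^ residueCard O)⁻¹ ∈ unitBall B _ h0 h1 :=
    mul_mem h3 (inv_mem (pow_mem (hpow _) _))
  have h5 := eq_one_of_toAdd_eq_zero E hO hc hK hpK ht ht' hρ
    (γ := γ' * (γ ^ residueCard O)⁻¹) (hlt _ (by simpa using h4)) h2
  have h6 : ρ φ * ρ γ * (ρ φ)⁻¹ = ρ γ ^ residueCard O := by
    rw [Subgroup.coe_mul, map_mul, Subgroup.coe_inv, map_inv, mul_inv_eq_one, hγ',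
      map_mul, map_mul, map_inv] at h5
    rw [h5, Subgroup.coe_pow, map_pow]
  have h7 := hx.conj (ρ φ)
  have h8 : (ρ φ : B) * ρ γ * ((ρ φ)⁻¹ : Bˣ) = (ρ γ : B) ^ residueCard O := by
    rw [← Units.val_mul, ← Units.val_mul, h6, Units.val_pow_eq_pow_val]
  rw [h8] at h7
  rw [h7.unique (hx.pow _), Nat.cast_smul_eq_nsmul]

/-- Exponentiating a nilpotent logarithm: first along the powers of a single inertia element, then
by density of `ℕ` in `ℤ_p`. -/
theorem exists_eq_exp_coeffCharacter (hO : ∀ x : K, x ∈ O ↔ ‖x‖ ≤ 1) {c : ℝ}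
    (hc : 0 < c) (hK : ∀ x : K, x ≠ 0 → ∃ k : ℤ, ‖x‖ = c ^ k) (hpK : ‖(p : K)‖ = 1)
    (ht : Continuous t) (ht' : Function.Surjective t) (hρ : Continuous ρ)
    {γ : inertiaGroup O} {n : ℕ} {x : B} (hn : n ≠ 0) (hγt : (t γ).toAdd = n)
    (hγ : ‖(ρ γ : B) - 1‖ < (p : ℝ)⁻¹) (hx : HasPadicLog p E (ρ γ : B) x) (hxn : IsNilpotent x) :
    ∃ U ∈ nhds (1 : AbsGal K), ∀ δ : inertiaGroup O, (δ : AbsGal K) ∈ U →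
      (ρ δ : B) = NormedSpace.exp (coeffCharacter E t δ • ((n : E)⁻¹ • x)) := by
  have := charZero_of_normedAlgebra_padic p E
  have hp0 : 0 < (p : ℝ)⁻¹ := inv_pos.2 (by exact_mod_cast hp.out.pos)
  have hp1 : (p : ℝ)⁻¹ < 1 := inv_lt_one_of_one_lt₀ (by exact_mod_cast hp.out.one_lt)
  set ε := max ((p : ℝ)⁻¹ / 2) ‖(ρ γ : B) - 1‖ with hε
  have h0 : 0 < ε := lt_max_of_lt_left (by positivity)
  have hεp : ε < (p : ℝ)⁻¹ := max_lt (by linarith) hγ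
  have h1 : ε < 1 := hεp.trans hp1
  have hγU : ρ γ ∈ unitBall B ε h0 h1 := mem_unitBall.2 (le_max_right _ _)
  obtain ⟨j, hj⟩ := hx.exists_pow_eq_exp hxn
  set N := (n : E)⁻¹ • x with hN
  have hNn : IsNilpotent N := hxn.smul _
  -- `ρ γ₀ = exp (n₀ N)` with `n₀ = t γ₀`
  set γ₀ := γ ^ p ^ j with hγ₀
  set n₀ := n * p ^ j with hn₀
  have hn₀0 : n₀ ≠ 0 := mul_ne_zero hn (pow_ne_zero _ hp.out.ne_zero)
  have hγ₀t : (t γ₀).toAdd = (n₀ : ℤ_[p]) := by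
    rw [hγ₀, map_pow, toAdd_pow, hγt, nsmul_eq_mul, hn₀]
    push_cast
    ring
  have hγ₀U : ρ γ₀ ∈ unitBall B ε h0 h1 := by
    rw [hγ₀, Subgroup.coe_pow, map_pow]
    exact pow_mem hγU _
  have hργ₀ : (ρ γ₀ : B) = NormedSpace.exp ((n₀ : E) • N) := by
    rw [hγ₀, Subgroup.coe_pow, map_pow, Units.val_pow_eq_pow_val, hj, hN, smul_smul, hn₀]
    congr 2
    have : (n : E) ≠ 0 := by exact_mod_cast hn
    push_cast
    field_simp
  obtain ⟨b, m₀, hm₀, hnb⟩ := Nat.exists_eq_pow_mul_and_not_dvd hn₀0 p hp.out.ne_one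
  have hm₀u : IsUnit (m₀ : ℤ_[p]) := by
    rw [PadicInt.isUnit_iff, PadicInt.norm_natCast_eq_one_iff]
    exact (hp.out.coprime_iff_not_dvd).2 hm₀
  obtain ⟨W, hW, hWt⟩ := exists_mem_nhds_pow_dvd (O := O) (t := t) ht b
  have hU : ρ ⁻¹' (unitBall B ε h0 h1) ∈ nhds (1 : AbsGal K) :=
    hρ.continuousAt.preimage_mem_nhds (by rw [map_one]; exact unitBall_mem_nhds h0 h1)
  refine ⟨_, Filter.inter_mem hU hW, fun δ hδ => ?_⟩
  obtain ⟨a, ha⟩ : ∃ a : ℤ_[p], (t δ).toAdd = n₀ * a := by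
    obtain ⟨a, ha⟩ := hWt δ hδ.2
    obtain ⟨u, hu⟩ := hm₀u
    refine ⟨(u⁻¹ : ℤ_[p]ˣ) * a, ?_⟩
    rw [ha, hnb, Nat.cast_mul, Nat.cast_pow, ← hu, mul_assoc, Units.mul_inv_cancel_left]
  -- approximate `δ` by the powers of `γ₀`
  let m : ℕ → ℕ := fun i => a.appr i
  have hm : ∀ i, (p : ℤ_[p]) ^ i ∣ a - m i := fun i =>
    Ideal.mem_span_singleton.1 (PadicInt.appr_spec i a)
  let η : ℕ → inertiaGroup O := fun i => δ * (γ₀ ^ m i)⁻¹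
  have hηt : ∀ i, (t (η i)).toAdd = n₀ * (a - m i) := by
    intro i
    simp only [η, map_mul, map_inv, map_pow, toAdd_mul, toAdd_inv, toAdd_pow, nsmul_eq_mul, hγ₀t, ha]
    ring
  have hηU : ∀ i, ρ (η i) ∈ unitBall B ε h0 h1 := by
    intro i
    have : ρ (η i) = ρ δ * (ρ γ₀ ^ m i)⁻¹ := by simp [η]
    rw [this]
    exact mul_mem hδ.1 (inv_mem (pow_mem hγ₀U _))
  have hη1 : Filter.Tendsto (fun i => (ρ (η i) : B)) Filter.atTop (nhds 1) := by
    rw [Metric.tendsto_atTop]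
    intro ε' hε'
    have h2 : 0 < min (ε' / 2) (1 / 2) := by positivity
    have h3 : min (ε' / 2) (1 / 2) < 1 := (min_le_right _ _).trans_lt (by norm_num)
    obtain ⟨k, hk⟩ := exists_forall_mem_unitBall E hO hc hK hpK ht ht' hρ h2 h3
    refine ⟨k, fun i hi => ?_⟩
    have h4 := mem_unitBall.1 (hk (η i) ((mem_unitBall.1 (hηU i)).trans_lt hεp) (by
      rw [hηt]
      exact (((pow_dvd_pow _ hi).trans (hm i))).mul_left _))
    rw [dist_eq_norm]
    have h5 := h4.trans (min_le_left _ _)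
    linarith
  have hlim : Filter.Tendsto (fun i => (m i : ℤ_[p])) Filter.atTop (nhds a) := by
    have h2 : Filter.Tendsto (fun i : ℕ => (p : ℝ)⁻¹ ^ i) Filter.atTop (nhds 0) :=
      tendsto_pow_atTop_nhds_zero_of_lt_one hp0.le hp1
    refine tendsto_iff_norm_sub_tendsto_zero.2 (squeeze_zero (fun _ => norm_nonneg _) (fun i => ?_) h2)
    rw [norm_sub_rev, inv_pow, ← zpow_natCast, ← zpow_neg, PadicInt.norm_le_pow_iff_mem_span_pow]
    exact PadicInt.appr_spec i a
  have hlimE : Filter.Tendsto (fun i => (m i : E) * n₀) Filter.atTop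
      (nhds (coeffCharacter E t δ)) := by
    have h2 : Continuous fun y : ℤ_[p] => algebraMap ℚ_[p] E (y : ℚ_[p]) :=
      (continuous_algebraMap ℚ_[p] E).comp continuous_subtype_val
    have h3 := ((h2.tendsto a).comp hlim).mul_const (n₀ : E)
    have h4 : coeffCharacter E t δ = algebraMap ℚ_[p] E (a : ℚ_[p]) * n₀ := by
      rw [coeffCharacter, ha, PadicInt.coe_mul, PadicInt.coe_natCast, map_mul, map_natCast,
        mul_comm]
    rw [h4]
    refine h3.congr fun i => ?_
    simp
  have hexp := hη1.mul (((NormedSpace.continuous_exp_smul hNn).tendsto _).comp hlimE)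
  rw [one_mul] at hexp
  refine tendsto_nhds_unique (tendsto_const_nhds.congr fun i => ?_) hexp
  have h2 : ρ δ = ρ (η i) * ρ γ₀ ^ m i := by simp [η]
  rw [h2, Units.val_mul, Units.val_pow_eq_pow_val, hργ₀,
    NormedSpace.exp_pow_of_isNilpotent E (hNn.smul _), smul_smul]
  rfl

end Representation

end Monodromy

/-! ### Uniqueness, and the associated Weil–Deligne representation -/

section ExpUnits

variable {E B : Type*} [NormedField E] [CharZero E] [Ring B] [Algebra E B]
  [TopologicalSpace B] [IsTopologicalRing B] [T2Space B]

variable (E) in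
include E in
omit [T2Space B] in
theorem NormedSpace.exp_units_conj_of_isNilpotent {x : B} (hx : IsNilpotent x) (g : Bˣ) :
    NormedSpace.exp (g * x * (g⁻¹ : Bˣ)) = g * NormedSpace.exp x * (g⁻¹ : Bˣ) := by
  obtain ⟨k, hk⟩ := hx
  have hk' : ((g : B) * x * (g⁻¹ : Bˣ)) ^ k = 0 := by
    rw [Units.conj_pow, hk, mul_zero, zero_mul]
  rw [NormedSpace.exp_eq_sum_of_pow_eq_zero E hk, NormedSpace.exp_eq_sum_of_pow_eq_zero E hk',
    Finset.mul_sum, Finset.sum_mul]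
  exact Finset.sum_congr rfl fun i _ => by
    rw [Units.conj_pow, mul_smul_comm, smul_mul_assoc]

/-- The one-parameter group `a ↦ exp (a N)` of a nilpotent element. -/
noncomputable def expUnits {N : B} (hN : IsNilpotent N) : Multiplicative E →* Bˣ :=
  MonoidHom.toHomUnits
    { toFun := fun a => NormedSpace.exp (a.toAdd • N)
      map_one' := by simp
      map_mul' := fun a b => by
        rw [toAdd_mul, add_smul]
        exact NormedSpace.exp_add_of_commute_of_isNilpotent E
          (((Commute.refl N).smul_left _).smul_right _) (hN.smul _) (hN.smul _) }

omit [T2Space B] in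
theorem coe_expUnits {N : B} (hN : IsNilpotent N) (a : E) :
    (expUnits hN (Multiplicative.ofAdd a) : B) = NormedSpace.exp (a • N) := rfl

omit [T2Space B] in
theorem expUnits_conj {N : B} (hN : IsNilpotent N) {g : Bˣ} {c : E}
    (h : (g : B) * N * (g⁻¹ : Bˣ) = c • N) (a : E) :
    g * expUnits hN (Multiplicative.ofAdd a) * g⁻¹ = expUnits hN (Multiplicative.ofAdd (c * a)) := by
  refine Units.ext ?_
  rw [Units.val_mul, Units.val_mul, coe_expUnits, coe_expUnits,
    ← NormedSpace.exp_units_conj_of_isNilpotent E (hN.smul a), mul_smul_comm, smul_mul_assoc, h,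
    smul_smul, mul_comm]

end ExpUnits

section WeilDeligne

variable {K : Type*} [NontriviallyNormedField K] [IsUltrametricDist K] [CompleteSpace K]
  {O : ValuationSubring K} {p : ℕ} [hp : Fact p.Prime]
  {E : Type*} [NormedField E] [NormedAlgebra ℚ_[p] E]
  {t : inertiaGroup O →* Multiplicative ℤ_[p]}

variable (E t) in
/-- The pairs `(σ, c)` such that conjugation by `σ` multiplies the character `t` by `c`. -/
noncomputable def conjScaling [hI : (inertiaGroup O).Normal] : Subgroup (AbsGal K × Eˣ) where
  carrier := {s | ∀ γ γ' : inertiaGroup O, (γ' : AbsGal K) = s.1 * γ * s.1⁻¹ →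
    coeffCharacter E t γ' = s.2 * coeffCharacter E t γ}
  one_mem' := fun γ γ' h => by
    obtain rfl : γ' = γ := Subtype.ext (by simpa using h)
    simp
  mul_mem' := by
    intro s₁ s₂ h₁ h₂ γ γ' h
    have h3 := h₂ γ ⟨_, hI.conj_mem _ γ.2 s₂.1⟩ rfl
    have h4 := h₁ ⟨_, hI.conj_mem _ γ.2 s₂.1⟩ γ' (by rw [h, Prod.fst_mul]; group)
    rw [h4, h3, Prod.snd_mul, Units.val_mul, mul_assoc]
  inv_mem' := by
    intro s h₁ γ γ' h
    have h2 := h₁ γ' γ (by rw [h, Prod.fst_inv]; group)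
    rw [h2, Prod.snd_inv, Units.inv_mul_cancel_left]

variable [hI : (inertiaGroup O).Normal]

omit [IsUltrametricDist K] [CompleteSpace K] in
theorem mem_conjScaling {σ : AbsGal K} {c : Eˣ} : (σ, c) ∈ conjScaling E t ↔
    ∀ γ γ' : inertiaGroup O, (γ' : AbsGal K) = σ * γ * σ⁻¹ →
      coeffCharacter E t γ' = c * coeffCharacter E t γ := Iff.rfl

omit [IsUltrametricDist K] [CompleteSpace K] in
theorem mem_conjScaling_one (ι : inertiaGroup O) : ((ι : AbsGal K), (1 : Eˣ)) ∈ conjScaling E t := by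
  intro γ γ' h
  obtain rfl : γ' = ι * γ * ι⁻¹ := Subtype.ext h
  rw [coeffCharacter_mul, coeffCharacter_mul, coeffCharacter_inv]
  simp

omit hI in
omit [IsUltrametricDist K] [CompleteSpace K] in
theorem exists_coeffCharacter_eq_one (ht' : Function.Surjective t) :
    ∃ τ : inertiaGroup O, ∀ n : ℕ, coeffCharacter E t (τ ^ n) = n := by
  obtain ⟨τ, hτ⟩ := ht' (Multiplicative.ofAdd 1)
  exact ⟨τ, fun n => by simp [coeffCharacter, hτ]⟩

variable {B : Type*} [Ring B] [Algebra E B] [TopologicalSpace B] [IsTopologicalRing B] [T2Space B]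
  [ContinuousSMul E B] {ρ : AbsGal K →* Bˣ}

omit hI in
omit [IsUltrametricDist K] [CompleteSpace K] in
/-- The monodromy operator is determined by the logarithm of a single inertia element. -/
theorem monodromy_unique (ht' : Function.Surjective t) {N₁ N₂ : B} (hN₁ : IsNilpotent N₁)
    (hN₂ : IsNilpotent N₂) {U₁ U₂ : Set (AbsGal K)} (hU₁ : U₁ ∈ nhds 1) (hU₂ : U₂ ∈ nhds 1)
    (h₁ : ∀ γ : inertiaGroup O, (γ : AbsGal K) ∈ U₁ →
      (ρ γ : B) = NormedSpace.exp (coeffCharacter E t γ • N₁))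
    (h₂ : ∀ γ : inertiaGroup O, (γ : AbsGal K) ∈ U₂ →
      (ρ γ : B) = NormedSpace.exp (coeffCharacter E t γ • N₂)) : N₁ = N₂ := by
  have := charZero_of_normedAlgebra_padic p E
  obtain ⟨n, hn, hpow⟩ := exists_pow_mem_of_mem_nhds (Filter.inter_mem hU₁ hU₂)
  obtain ⟨τ, hτ⟩ := exists_coeffCharacter_eq_one (E := E) ht'
  have h3 := h₁ (τ ^ n) (hpow τ).1
  rw [h₂ (τ ^ n) (hpow τ).2, hτ] at h3
  have h4 := hasPadicLog_exp (p := p) (E := E) (hN₁.smul (n : E))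
  rw [← h3] at h4
  have h5 := h4.unique (hasPadicLog_exp (hN₂.smul (n : E)))
  exact smul_right_injective B (by exact_mod_cast hn : (n : E) ≠ 0) h5

omit [IsUltrametricDist K] [CompleteSpace K] in
/-- `ρ σ` scales the monodromy operator as conjugation by `σ` scales `t`. -/
theorem monodromy_conj (ht' : Function.Surjective t) {N : B} (hN : IsNilpotent N)
    {U : Set (AbsGal K)} (hU : U ∈ nhds 1) (h : ∀ γ : inertiaGroup O, (γ : AbsGal K) ∈ U →
      (ρ γ : B) = NormedSpace.exp (coeffCharacter E t γ • N)) {σ : AbsGal K} {c : Eˣ}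
    (hσ : (σ, c) ∈ conjScaling E t) : (ρ σ : B) * N * ((ρ σ)⁻¹ : Bˣ) = (c : E) • N := by
  have := charZero_of_normedAlgebra_padic p E
  obtain ⟨n, hn, hpow⟩ := exists_pow_mem_of_mem_nhds hU
  obtain ⟨τ, hτ⟩ := exists_coeffCharacter_eq_one (E := E) ht'
  -- compare the logarithms of `ρ (σ τ ^ n σ⁻¹)` computed in two ways
  let δ : inertiaGroup O := ⟨σ * (τ ^ n : inertiaGroup O) * σ⁻¹, hI.conj_mem _ (τ ^ n).2 σ⟩
  have hδ : coeffCharacter E t δ = c * n := by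
    rw [mem_conjScaling.1 hσ (τ ^ n) δ rfl, hτ]
  have hδU : (δ : AbsGal K) ∈ U := by
    have : (δ : AbsGal K) = (σ * τ * σ⁻¹) ^ n := by rw [conj_pow]; rfl
    rw [this]
    exact hpow _
  have h1 : (ρ δ : B) = (ρ σ : B) * ρ (τ ^ n : inertiaGroup O) * ((ρ σ)⁻¹ : Bˣ) := by
    rw [← Units.val_mul, ← Units.val_mul, ← map_inv, ← map_mul, ← map_mul]
  rw [h δ hδU, h _ (hpow _), hδ, hτ] at h1
  have h2 := (hasPadicLog_exp (p := p) (E := E) (hN.smul (n : E))).conj (ρ σ)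
  rw [← h1] at h2
  have h3 := h2.unique (hasPadicLog_exp (hN.smul _))
  rw [mul_smul_comm, smul_mul_assoc, mul_comm, mul_smul] at h3
  exact smul_right_injective B (by exact_mod_cast hn : (n : E) ≠ 0) h3

section Existence

variable (hO : ∀ x : K, x ∈ O ↔ ‖x‖ ≤ 1) {q : Eˣ} (hq1 : ∀ i : ℤ, q ^ i = 1 → i = 0)
  (hS : ∀ φ : AbsGal K, IsArithFrobenius O φ → (φ, q) ∈ conjScaling E t)

include hO in
omit hI in
/-- Two Frobenius elements differ by inertia. -/
theorem inv_mul_mem_inertiaGroup {φ φ' : AbsGal K} (hφ : IsArithFrobenius O φ)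
    (hφ' : IsArithFrobenius O φ') : φ⁻¹ * φ' ∈ inertiaGroup O := by
  rw [isArithFrobenius_iff hO] at hφ hφ'
  rw [mem_inertiaGroup_iff hO]
  intro x hx
  have h1 : φ ((φ⁻¹ * φ') x - x) = (φ' x - x ^ residueCard O) - (φ x - x ^ residueCard O) := by
    rw [map_sub, ← AlgEquiv.mul_apply, mul_inv_cancel_left]
    ring
  rw [← spectralNorm_absGal φ, h1]
  exact (spectralNorm_sub_le _ _).trans_lt (max_lt (hφ' x hx) (hφ x hx))

include hO in
theorem exists_eq_zpow_mul {Φ : AbsGal K} (hΦ : IsGeomFrobenius O Φ) {σ : AbsGal K}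
    (hσ : σ ∈ weilGroup O) : ∃ (s : ℤ) (γ : inertiaGroup O), σ = Φ ^ s * γ := by
  have hle : weilGroup O ≤ Subgroup.zpowers Φ ⊔ inertiaGroup O := by
    refine sup_le ((Subgroup.closure_le _).2 fun φ hφ => ?_) le_sup_right
    have h1 := inv_mul_mem_inertiaGroup hO hΦ hφ
    rw [inv_inv] at h1
    rw [← inv_mul_cancel_left Φ φ]
    exact mul_mem (inv_mem (Subgroup.mem_sup_left (Subgroup.mem_zpowers Φ)))
      (Subgroup.mem_sup_right h1)
  obtain ⟨_, ⟨s, rfl⟩, γ, hγ, h⟩ := Subgroup.mem_sup_of_normal_right.1 (hle hσ)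
  exact ⟨s, ⟨γ, hγ⟩, h.symm⟩

include hS in
omit [IsUltrametricDist K] [CompleteSpace K] in
theorem mem_conjScaling_zpow_mul {Φ : AbsGal K} (hΦ : IsGeomFrobenius O Φ) (s : ℤ)
    (γ : inertiaGroup O) : (Φ ^ s * (γ : AbsGal K), q ^ (-s)) ∈ conjScaling E t := by
  have h1 := mul_mem (zpow_mem (inv_mem (hS _ hΦ)) s) (mem_conjScaling_one (E := E) (t := t) γ)
  simpa using h1

include hS in
omit [IsUltrametricDist K] [CompleteSpace K] in
theorem mem_conjScaling_of_hasFrobeniusDegree {σ : AbsGal K} {d : ℤ}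
    (h : HasFrobeniusDegree O σ d) : (σ, q ^ d) ∈ conjScaling E t := by
  obtain ⟨φ, hφ, h⟩ := h
  have h1 := mul_mem (zpow_mem (hS _ hφ) d) (mem_conjScaling_one (E := E) (t := t) ⟨_, h⟩)
  simpa using h1

include hq1 hS in
omit [IsUltrametricDist K] [CompleteSpace K] in
/-- A nonzero power of Frobenius is not inertial, as it does not commute with the values of `t`. -/
theorem zpow_mul_injective (ht' : Function.Surjective t) {Φ : AbsGal K}
    (hΦ : IsGeomFrobenius O Φ) {s s' : ℤ} {γ γ' : inertiaGroup O}
    (h : Φ ^ s * (γ : AbsGal K) = Φ ^ s' * γ') : s = s' ∧ γ = γ' := by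
  obtain ⟨τ, hτ⟩ := exists_coeffCharacter_eq_one (E := E) ht'
  have h1 := mem_conjScaling_zpow_mul hS hΦ s γ
  rw [h] at h1
  have h2 := mul_mem (inv_mem (mem_conjScaling_zpow_mul hS hΦ s' γ')) h1
  have h3 := mem_conjScaling.1 (show ((1 : AbsGal K), q ^ s' * q ^ (-s)) ∈ conjScaling E t by
    simpa using h2) (τ ^ 1) (τ ^ 1) (by simp)
  rw [hτ, Nat.cast_one, mul_one, ← zpow_add] at h3
  have h4 := hq1 _ (Units.ext h3.symm)
  obtain rfl : s = s' := by omega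
  exact ⟨rfl, Subtype.ext (mul_left_cancel h)⟩

include hO hq1 hS in
/-- The homomorphism is `Φ ^ s γ ↦ ρ (Φ ^ s γ) exp (-t(γ) N)`. It is multiplicative because moving
`exp (t(γ) N)` past `ρ (Φ ^ s)` and moving `γ` past `Φ ^ s` both scale `t(γ)` by `q ^ s`. -/
theorem existsUnique_weilDeligne (ht' : Function.Surjective t) {N : B} (hN : IsNilpotent N)
    {U : Set (AbsGal K)} (hU : U ∈ nhds 1) (h : ∀ γ : inertiaGroup O, (γ : AbsGal K) ∈ U →
      (ρ γ : B) = NormedSpace.exp (coeffCharacter E t γ • N)) {Φ : AbsGal K}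
    (hΦ : IsGeomFrobenius O Φ) :
    ∃! r : weilGroup O →* Bˣ,
      (∀ (σ : weilGroup O) (s : ℤ) (γ : inertiaGroup O), (σ : AbsGal K) = Φ ^ s * (γ : AbsGal K) →
        (ρ (σ : AbsGal K) : B) = r σ * NormedSpace.exp (coeffCharacter E t γ • N)) ∧
      (∃ J : OpenSubgroup (inertiaGroup O),
        ∀ γ ∈ J, r (Subgroup.inclusion (inertiaGroup_le_weilGroup O) γ) = 1) ∧
      ∀ (σ : weilGroup O) (d : ℤ), HasFrobeniusDegree O (σ : AbsGal K) d →
        (r σ : B) * N * ((r σ)⁻¹ : Bˣ) = ((q ^ d : Eˣ) : E) • N := by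
  have := charZero_of_normedAlgebra_padic p E
  let e : E → Bˣ := fun a => expUnits hN (Multiplicative.ofAdd a)
  have he : ∀ a, (e a : B) = NormedSpace.exp (a • N) := coe_expUnits hN
  have he_add : ∀ a b, e (a + b) = e a * e b := fun a b => by
    simp only [e, ofAdd_add, map_mul]
  choose s γ hsγ using fun σ : weilGroup O => exists_eq_zpow_mul hO hΦ σ.2
  have hconj : ∀ σ : weilGroup O, (ρ σ : B) * N * ((ρ σ)⁻¹ : Bˣ) = ((q ^ (-s σ) : Eˣ) : E) • N := by
    intro σ
    refine monodromy_conj ht' hN hU h ?_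
    have h1 := mem_conjScaling_zpow_mul hS hΦ (s σ) (γ σ)
    rwa [← hsγ] at h1
  have hmul : ∀ σ τ : weilGroup O, coeffCharacter E t (γ (σ * τ)) =
      ((q ^ s τ : Eˣ) : E) * coeffCharacter E t (γ σ) + coeffCharacter E t (γ τ) := by
    intro σ τ
    let δ : inertiaGroup O := ⟨Φ ^ (-s τ) * γ σ * (Φ ^ (-s τ))⁻¹, hI.conj_mem _ (γ σ).2 _⟩
    have h1 : Φ ^ s (σ * τ) * (γ (σ * τ) : AbsGal K) =
        Φ ^ (s σ + s τ) * ((δ * γ τ : inertiaGroup O) : AbsGal K) := by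
      rw [← hsγ, Subgroup.coe_mul, Subgroup.coe_mul, hsγ σ, hsγ τ]
      change _ = Φ ^ (s σ + s τ) * (Φ ^ (-s τ) * γ σ * (Φ ^ (-s τ))⁻¹ * γ τ)
      group
    have h2 := mem_conjScaling_zpow_mul hS hΦ (-s τ) 1
    rw [neg_neg, OneMemClass.coe_one, mul_one] at h2
    rw [(zpow_mul_injective hq1 hS ht' hΦ h1).2, coeffCharacter_mul,
      mem_conjScaling.1 h2 (γ σ) δ rfl]
  have hcomm : ∀ (σ : weilGroup O) (a : E),
      e (((q ^ s σ : Eˣ) : E) * a) = (ρ σ)⁻¹ * e a * ρ σ := by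
    intro σ a
    have h1 := expUnits_conj hN (hconj σ) (((q ^ s σ : Eˣ) : E) * a)
    rw [← mul_assoc, ← Units.val_mul, ← zpow_add, neg_add_cancel, zpow_zero, Units.val_one,
      one_mul] at h1
    change ρ σ * e _ * (ρ σ)⁻¹ = e a at h1
    rw [← h1]
    group
  let r : weilGroup O →* Bˣ := MonoidHom.mk' (fun σ => ρ σ * (e (coeffCharacter E t (γ σ)))⁻¹) (by
    intro σ τ
    rw [hmul, add_comm, he_add, hcomm, Subgroup.coe_mul, map_mul]
    group)
  have hr : ∀ (σ : weilGroup O) (s' : ℤ) (γ' : inertiaGroup O),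
      (σ : AbsGal K) = Φ ^ s' * (γ' : AbsGal K) → r σ = ρ σ * (e (coeffCharacter E t γ'))⁻¹ := by
    intro σ s' γ' hσ
    rw [← (zpow_mul_injective hq1 hS ht' hΦ ((hsγ σ).symm.trans hσ)).2]
    rfl
  refine ⟨r, ⟨fun σ s' γ' hσ => ?_, ?_, fun σ d hd => ?_⟩, fun r' hr' => ?_⟩
  · rw [← he, hr σ s' γ' hσ, ← Units.val_mul, inv_mul_cancel_right]
  · refine exists_openSubgroup_inertia_iff.2 ⟨U, hU, fun δ hδ => ?_⟩
    rw [hr _ 0 δ (by simp), mul_inv_eq_one]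
    exact Units.ext (h δ hδ)
  · have h1 := monodromy_conj ht' hN hU h (mem_conjScaling_of_hasFrobeniusDegree hS hd)
    have h2 : (((e (coeffCharacter E t (γ σ)))⁻¹ : Bˣ) : B) * N *
        (e (coeffCharacter E t (γ σ)) : B) = N := by
      have h4 : Commute N (e (coeffCharacter E t (γ σ)) : B) := by
        rw [he]
        exact ((Commute.refl N).smul_right _).exp_right
      rw [mul_assoc, h4.eq, Units.inv_mul_cancel_left]
    have h3 : ((r σ)⁻¹ : Bˣ) = e (coeffCharacter E t (γ σ)) * (ρ σ)⁻¹ := by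
      rw [hr σ _ _ (hsγ σ), mul_inv_rev, inv_inv]
    rw [h3, hr σ _ _ (hsγ σ), Units.val_mul, Units.val_mul, ← h1]
    conv_rhs => rw [← h2]
    simp only [mul_assoc]
  · ext1 σ
    have h1 := hr'.1 σ (s σ) (γ σ) (hsγ σ)
    rw [hr σ _ _ (hsγ σ), eq_mul_inv_iff_mul_eq]
    refine Units.ext ?_
    rw [h1, Units.val_mul, he]

end Existence

end WeilDeligne

/-! ### Completions of number fields at finite places -/

section AdicCompletion

variable (F : Type*) [Field F] [NumberField F] (w : HeightOneSpectrum (𝓞 F))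

theorem mem_adicCompletionIntegers_iff_norm (x : w.adicCompletion F) :
    x ∈ w.adicCompletionIntegers F ↔ ‖x‖ ≤ 1 := by
  rw [HeightOneSpectrum.mem_adicCompletionIntegers]
  exact Valued.toNormedField.norm_le_one_iff.symm

theorem exists_norm_eq_zpow : ∃ c : ℝ, 0 < c ∧
    ∀ x : w.adicCompletion F, x ≠ 0 → ∃ k : ℤ, ‖x‖ = c ^ k := by
  refine ⟨(Ideal.absNorm w.asIdeal : ℝ), ?_, fun x hx => ?_⟩
  · exact_mod_cast one_pos.trans (HeightOneSpectrum.one_lt_absNorm w)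
  · have h0 : (Valued.v x : WithZero (Multiplicative ℤ)) ≠ 0 := (Valuation.ne_zero_iff _).2 hx
    refine ⟨(WithZero.unzero h0).toAdd, ?_⟩
    rw [FinitePlace.norm_def, WithZeroMulInt.toNNReal_neg_apply _ h0]
    simp

theorem norm_natCast_eq_one {p : ℕ} (hw : (p : 𝓞 F) ∉ w.asIdeal) :
    ‖(p : w.adicCompletion F)‖ = 1 := by
  have := (FinitePlace.norm_eq_one_iff_notMem F w (p : 𝓞 F)).2 hw
  simpa using this

theorem finite_residueField_adicCompletionIntegers :
    Finite (IsLocalRing.ResidueField (w.adicCompletionIntegers F)) := by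
  let f : 𝓞 F →+* IsLocalRing.ResidueField (w.adicCompletionIntegers F) :=
    (IsLocalRing.residue _).comp (algebraMap (𝓞 F) (w.adicCompletionIntegers F))
  have hres : ∀ x : w.adicCompletionIntegers F, Valued.v (x : w.adicCompletion F) < 1 →
      IsLocalRing.residue (w.adicCompletionIntegers F) x = 0 := by
    intro x hx
    rw [IsLocalRing.residue_eq_zero_iff, IsLocalRing.mem_maximalIdeal, mem_nonunits_iff,
      HeightOneSpectrum.adicCompletionIntegers.isUnit_iff_valued_eq_one]
    exact hx.ne
  have hf0 : ∀ r ∈ w.asIdeal, f r = 0 := by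
    intro r hr
    refine hres _ ?_
    rw [HeightOneSpectrum.algebraMap_adicCompletionIntegers_apply,
      HeightOneSpectrum.valuedAdicCompletion_eq_valuation', HeightOneSpectrum.valuation_lt_one_iff_mem]
    exact hr
  have hf : Function.Surjective f := by
    intro y
    obtain ⟨x, rfl⟩ := IsLocalRing.residue_surjective y
    -- approximate first by an element of `F`, then by an element of `𝓞 F`
    obtain ⟨z, hz⟩ := (HeightOneSpectrum.denseRange_algebraMap F w).exists_dist_lt
      (x : w.adicCompletion F) one_pos
    rw [dist_eq_norm, Valued.toNormedField.norm_lt_one_iff] at hz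
    have hz1 : Valued.v (algebraMap F (w.adicCompletion F) z) ≤ 1 := by
      have h1 : algebraMap F (w.adicCompletion F) z =
          x - ((x : w.adicCompletion F) - algebraMap F (w.adicCompletion F) z) := by ring
      rw [h1]
      exact Valuation.map_sub_le (v := Valued.v) x.2 hz.le
    obtain ⟨a, ha⟩ := w.exists_valuation_sub_lt_of_integer (K := F) (x := z)
      (by rwa [← HeightOneSpectrum.valuedAdicCompletion_eq_valuation']) 1
    rw [← HeightOneSpectrum.valuedAdicCompletion_eq_valuation'] at ha
    refine ⟨a, sub_eq_zero.1 ?_⟩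
    change IsLocalRing.residue _ _ - _ = 0
    rw [← map_sub]
    refine hres _ ?_
    have h1 : ((algebraMap (𝓞 F) (w.adicCompletionIntegers F) a - x :
        w.adicCompletionIntegers F) : w.adicCompletion F) =
          algebraMap F (w.adicCompletion F) (algebraMap (𝓞 F) F a - z) -
            ((x : w.adicCompletion F) - algebraMap F (w.adicCompletion F) z) := by
      rw [map_sub, sub_sub_sub_cancel_right]
      rfl
    rw [h1]
    exact Valuation.map_sub_lt _ ha hz
  have : Finite (𝓞 F ⧸ w.asIdeal) := w.asIdeal.finiteQuotientOfFreeOfNeBot w.ne_bot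
  exact Finite.of_surjective (Ideal.Quotient.lift w.asIdeal f hf0)
    (Ideal.Quotient.lift_surjective_of_surjective _ _ hf)

theorem charZero_adicCompletion : CharZero (w.adicCompletion F) :=
  charZero_of_injective_algebraMap (algebraMap F (w.adicCompletion F)).injective

theorem exists_one_lt_norm_adicCompletion : ∃ x : w.adicCompletion F, 1 < ‖x‖ := by
  obtain ⟨r, hr, hr0⟩ := Submodule.exists_mem_ne_zero_of_ne_bot w.ne_bot
  have h1 := (FinitePlace.norm_lt_one_iff_mem F w r).2 hr
  refine ⟨(FinitePlace.embedding w (algebraMap _ F r))⁻¹, ?_⟩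
  rw [norm_inv]
  exact (one_lt_inv₀ (norm_pos_iff.2 (by simpa using hr0))).2 h1

/-- The completion at a finite place as a nontrivially normed field. -/
noncomputable abbrev adicCompletionNontriviallyNormedField :
    NontriviallyNormedField (w.adicCompletion F) where
  __ := NumberField.HeightOneSpectrum.instNormedFieldValuedAdicCompletion F w
  non_trivial := exists_one_lt_norm_adicCompletion F w

end AdicCompletion

/-! ### The monodromy theorem -/

section MatrixNorm

variable {A : Type*} [NormedCommRing A] [IsUltrametricDist A] {n : ℕ}

variable (A n) in
/-- The maximum of the norms of the entries, as a ring norm on matrices over an ultrametric ring.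
It induces the product topology. -/
noncomputable abbrev Matrix.supNormedRing : NormedRing (Matrix (Fin n) (Fin n) A) where
  __ := Matrix.normedAddCommGroup (m := Fin n) (n := Fin n) (α := A)
  __ := (inferInstance : Ring (Matrix (Fin n) (Fin n) A))
  norm_mul_le M N := by
    let _ := Matrix.normedAddCommGroup (m := Fin n) (n := Fin n) (α := A)
    refine (Matrix.norm_le_iff (mul_nonneg (norm_nonneg M) (norm_nonneg N))).2 fun i j => ?_
    rw [Matrix.mul_apply]
    refine IsUltrametricDist.norm_sum_le_of_forall_le_of_nonneg
      (mul_nonneg (norm_nonneg M) (norm_nonneg N)) fun k _ => ?_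
    exact (norm_mul_le _ _).trans (mul_le_mul (Matrix.norm_entry_le_entrywise_sup_norm M)
      (Matrix.norm_entry_le_entrywise_sup_norm N) (norm_nonneg _) (norm_nonneg _))

theorem Matrix.isUltrametricDist_supNorm :
    let _ := Matrix.supNormedRing A n
    IsUltrametricDist (Matrix (Fin n) (Fin n) A) := by
  intro _
  refine IsUltrametricDist.isUltrametricDist_of_forall_norm_add_le_max_norm fun M N => ?_
  refine (Matrix.norm_le_iff (le_max_of_le_left (norm_nonneg M))).2 fun i j => ?_
  exact (IsUltrametricDist.norm_add_le_max _ _).trans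
    (max_le_max (Matrix.norm_entry_le_entrywise_sup_norm M)
      (Matrix.norm_entry_le_entrywise_sup_norm N))

end MatrixNorm

section Monodromy

variable {K : Type*} [NontriviallyNormedField K] [IsUltrametricDist K] [CompleteSpace K]
  {O : ValuationSubring K} {p : ℕ} [hp : Fact p.Prime]

/-- The monodromy theorem over a complete discretely valued field with finite residue field of
characteristic different from `p`, and with coefficients in any commutative ultrametric Banach
algebra over an extension of `ℚ_[p]`. -/
theorem monodromy_and_weilDeligne [PerfectField K] [Finite (IsLocalRing.ResidueField O)]
    (hO : ∀ x : K, x ∈ O ↔ ‖x‖ ≤ 1) {c : ℝ} (hc : 0 < c)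
    (hK : ∀ x : K, x ≠ 0 → ∃ k : ℤ, ‖x‖ = c ^ k) (hpK : ‖(p : K)‖ = 1)
    {E : Type*} [NormedField E] [NormedAlgebra ℚ_[p] E]
    {A : Type*} [NormedCommRing A] [NormedAlgebra E A] [CompleteSpace A] [IsUltrametricDist A]
    {t : inertiaGroup O →* Multiplicative ℤ_[p]} (ht : Continuous t) (ht' : Function.Surjective t)
    {n : ℕ} {ρ : AbsGal K →* GL (Fin n) A} (hρ : Continuous ρ) :
    (∃! N : Matrix (Fin n) (Fin n) A, IsMonodromyOperator E O t ρ N) ∧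
    ∀ N : Matrix (Fin n) (Fin n) A, IsMonodromyOperator E O t ρ N →
      ∀ Φ : AbsGal K, IsGeomFrobenius O Φ →
        ∃! r : weilGroup O →* GL (Fin n) A,
          (∀ (σ : weilGroup O) (s : ℤ) (γ : inertiaGroup O),
            (σ : AbsGal K) = Φ ^ s * (γ : AbsGal K) →
            (ρ (σ : AbsGal K) : Matrix (Fin n) (Fin n) A) =
              (r σ : Matrix (Fin n) (Fin n) A) *
                NormedSpace.exp (algebraMap ℚ_[p] E ((t γ).toAdd : ℚ_[p]) • N)) ∧
          IsWeilDeligneRep E O r N := by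
  have hE := charZero_of_normedAlgebra_padic p E
  have hI := normal_inertiaGroup hO
  obtain ⟨φ, hφ⟩ := exists_isArithFrobenius hO
  have hq2 : 2 ≤ residueCard O := Finite.one_lt_card
  have hqE : (residueCard O : E) ≠ 0 := by
    exact_mod_cast (by omega : residueCard O ≠ 0)
  have hqpow : ∀ i : ℕ, i ≠ 0 → (residueCard O : E) ^ i ≠ 1 := by
    intro i hi
    exact_mod_cast (Nat.one_lt_pow hi (by omega)).ne'
  have hiff : ∀ N : Matrix (Fin n) (Fin n) A,
      IsMonodromyOperator E O t ρ N ↔ IsNilpotent N ∧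
        ∃ U ∈ nhds (1 : AbsGal K),
          ∀ γ : inertiaGroup O, (γ : AbsGal K) ∈ U →
            (ρ γ : Matrix (Fin n) (Fin n) A) = NormedSpace.exp (coeffCharacter E t γ • N) :=
    fun N => and_congr_right fun _ => exists_openSubgroup_inertia_iff
  refine ⟨?_, fun N hN Φ hΦ => ?_⟩
  · have hex : ∃ N, IsMonodromyOperator E O t ρ N := by
      let _ := Matrix.supNormedRing A n
      let _ : NormedAlgebra E (Matrix (Fin n) (Fin n) A) :=
        { (inferInstance : Algebra E (Matrix (Fin n) (Fin n) A)) with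
          norm_smul_le := (Matrix.normedSpace (R := E) (m := Fin n) (n := Fin n) (α := A)).norm_smul_le }
      have := Matrix.isUltrametricDist_supNorm (A := A) (n := n)
      have : @CompleteSpace (Matrix (Fin n) (Fin n) A)
          (Matrix.supNormedRing A n).toPseudoMetricSpace.toUniformSpace :=
        inferInstanceAs (CompleteSpace (Fin n → Fin n → A))
      obtain ⟨γ, m, x, hm, hγt, hγ, hx, hconj⟩ :=
        exists_hasPadicLog_rep (E := E) hO hc hK hpK ht ht' hρ hφ
      have hxn : IsNilpotent x := Matrix.isNilpotent_of_conj_eq_smul hqE hqpow hconj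
      exact ⟨_, (hiff _).2 ⟨hxn.smul _,
        exists_eq_exp_coeffCharacter hO hc hK hpK ht ht' hρ hm hγt hγ hx hxn⟩⟩
    obtain ⟨N, hN⟩ := hex
    refine ⟨N, hN, fun N' hN' => ?_⟩
    obtain ⟨hNn, U, hU, h⟩ := (hiff N).1 hN
    obtain ⟨hNn', U', hU', h'⟩ := (hiff N').1 hN'
    exact monodromy_unique ht' hNn' hNn hU' hU h' h
  · obtain ⟨hNn, U, hU, h⟩ := (hiff N).1 hN
    have hS : ∀ φ : AbsGal K,
        IsArithFrobenius O φ →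
          (φ, Units.mk0 _ hqE) ∈ conjScaling E t := by
      intro φ hφ γ γ' hγ'
      rw [coeffCharacter, toAdd_conj_arithFrobenius hO hc hK hpK ht hφ γ γ' hγ', PadicInt.coe_mul,
        PadicInt.coe_natCast, map_mul, map_natCast]
      rfl
    have hq1 : ∀ i : ℤ, Units.mk0 _ hqE ^ i = 1 → i = 0 := by
      intro i hi
      have h1 : ∀ j : ℕ, j ≠ 0 → Units.mk0 _ hqE ^ j ≠ 1 := fun j hj h1 =>
        hqpow j hj (by simpa using congrArg Units.val h1)
      by_contra h0
      obtain ⟨j, rfl | rfl⟩ := i.eq_nat_or_neg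
      · exact h1 j (by simpa using h0) (by simpa using hi)
      · exact h1 j (by simpa using h0) (by simpa using hi)
    obtain ⟨r, ⟨hr, hsmooth, hrel⟩, huniq⟩ :=
      existsUnique_weilDeligne hO hq1 hS ht' hNn hU h hΦ
    refine ⟨r, ⟨hr, hNn, hsmooth, fun σ d hd => ?_⟩, fun r' hr' => huniq r' ⟨hr'.1, hr'.2.smooth,
      fun σ d hd => ?_⟩⟩
    · simpa using hrel σ d hd
    · simpa using hr'.2.relation σ d hd

end Monodromy

theorem mainTheorem8
    (p : ℕ) [Fact p.Prime]
    -- a finite place `w` of a number field, not dividing `p`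
    (F : Type*) [Field F] [NumberField F]
    (w : HeightOneSpectrum (𝓞 F)) (hw : (p : 𝓞 F) ∉ w.asIdeal)
    -- a finite extension of `ℚ_p`, with its absolute value
    (E : Type*) [NormedField E] [IsUltrametricDist E] [NormedAlgebra ℚ_[p] E]
    [FiniteDimensional ℚ_[p] E]
    (A : Type*) [NormedCommRing A] [NormedAlgebra E A] (hA : IsAffinoidAlgebra E A)
    (t : inertiaGroup (w.adicCompletionIntegers F) →* Multiplicative ℤ_[p])
    (ht : Continuous t) (ht' : Function.Surjective t)
    (n : ℕ) (ρ : AbsGal (w.adicCompletion F) →* GL (Fin n) A) (hρ : Continuous ρ) :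
    (∃! N : Matrix (Fin n) (Fin n) A,
      IsMonodromyOperator E (w.adicCompletionIntegers F) t ρ N) ∧
    ∀ N : Matrix (Fin n) (Fin n) A,
      IsMonodromyOperator E (w.adicCompletionIntegers F) t ρ N →
      ∀ Φ : AbsGal (w.adicCompletion F), IsGeomFrobenius (w.adicCompletionIntegers F) Φ →
        ∃! r : weilGroup (w.adicCompletionIntegers F) →* GL (Fin n) A,
          (∀ (σ : weilGroup (w.adicCompletionIntegers F)) (s : ℤ)
            (γ : inertiaGroup (w.adicCompletionIntegers F)),
            (σ : AbsGal (w.adicCompletion F)) = Φ ^ s * (γ : AbsGal (w.adicCompletion F)) →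
            (ρ (σ : AbsGal (w.adicCompletion F)) : Matrix (Fin n) (Fin n) A) =
              (r σ : Matrix (Fin n) (Fin n) A) *
                NormedSpace.exp (algebraMap ℚ_[p] E ((t γ).toAdd : ℚ_[p]) • N)) ∧
          IsWeilDeligneRep E (w.adicCompletionIntegers F) r N := by

  obtain ⟨hcomplete, hultra, -⟩ := hA
  obtain ⟨c, hc, hK⟩ := exists_norm_eq_zpow F w
  have hchar := charZero_adicCompletion F w
  have hperf : PerfectField (w.adicCompletion F) := inferInstance
  have hfin := finite_residueField_adicCompletionIntegers F w
  exact @monodromy_and_weilDeligne (w.adicCompletion F) (adicCompletionNontriviallyNormedField F w)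
    (inferInstanceAs (IsUltrametricDist (w.adicCompletion F)))
    (inferInstanceAs (CompleteSpace (w.adicCompletion F))) (w.adicCompletionIntegers F) p _
    hperf hfin (mem_adicCompletionIntegers_iff_norm F w) c hc hK
    (norm_natCast_eq_one F w hw) E _ _ A _ _ hcomplete hultra t ht ht' n ρ hρ
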